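/- **Setting.** Let $X$ be a complex Banach space, $E=\ell^2(\mathbb Z,X)$, and let $A\in L(E)$ be a bounded operator whose matrix $[a_{i,j}]_{i,j\in\mathbb Z}$, $a_{i,j}\in L(X)$, is tridiagonal, i.e. $a_{i,j}=0$ for $|i-j|>1$. Put $\alpha_j=a_{j+1,j}$, $\gamma_j=a_{j-1,j}$, $\|\alpha\|_\infty=\sup_j\|\alpha_j\|$, $\|\gamma\|_\infty=\sup_j\|\gamma_j\|$. For $n\in\mathbb N=\{1,2,\dots\}$ and $k\in\mathbb Z$ let $A_{n,k}=[a_{i,j}]_{i,j=k+1}^{k+n}$, acting on $X^n$ with the norm $(\sum_j\|x_j\|^2)^{1/2}$. For a bounded operator $B$, with the conventions $\|B^{-1}\|=\infty$ if $B$ is not invertible and $1/\infty=0$, let $$\mathrm{spec}_\varepsilon B=\{\lambda\in\mathbb C: 1/\|(B-\lambda I)^{-1}\|<\varepsilon\}\ (\varepsilon>0),\qquad \mathrm{Spec}_\varepsilon B=\{\lambda\in\mathbb C: 1/\|(B-\lambda I)^{-1}\|\le\varepsilon\}\ (\varepsilon\ge 0),$$ so that $\mathrm{Spec}_0B$ is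 the spectrum $\mathrm{Spec}\,B$, and let $$\sigma^n_\varepsilon(A)=\bigcup_{k\in\mathbb Z}\mathrm{spec}_\varepsilon A_{n,k},\qquad \Sigma^n_\varepsilon(A)=\overline{\bigcup_{k\in\mathbb Z}\mathrm{Spec}_\varepsilon A_{n,k}} .$$ The space $X$ has *Globevnik's property* if $X$ is finite-dimensional, or $X$ or its dual $X^*$ is complex uniformly convex; here $Y$ is complex uniformly convex if for every $\varepsilon>0$ there is $\delta>0$ such that $\|x\|\le 1-\delta$ whenever $x,y\in Y$, $\|y\|\ge\varepsilon$ and $\|x+\zeta y\|\le 1$ for all $\zeta\in\mathbb C$ with $|\zeta|\le 1$. **Theorem.** Let $n\in\mathbb N$. 1. For every $\varphi\in(0,1)$ the equation $$2\sin\tfrac t2\,\cos\big((n+\tfrac12)t\big)+\varphi(1-\varphi)\sin\big((n-1)t\big)=0$$ has exactly one solution $t=\theta_n(\varphi)$ in $\big[\tfrac{\pi}{2n+1},\tfrac{\pi}{n+2}\big]$. Put $$\varepsilon_n=\varepsilon_n(A):=2\inf_{0<\varphi<1}\left(\sqrt{\frac{\|\alpha\|_\infty^2}{\varphi}+\frac{\|\gamma\|_\infty^2}{1-\varphi}}\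 \sin\frac{\theta_n(\varphi)}2\right).$$ 2. For every $\varepsilon>0$: $\ \mathrm{spec}_\varepsilon A\subset\sigma^n_{\varepsilon+\varepsilon_n}(A)$. 3. If $X$ has Globevnik's property, then $\mathrm{Spec}_\varepsilon A\subset\Sigma^n_{\varepsilon+\varepsilon_n}(A)$ for every $\varepsilon\ge0$, where in the case $\varepsilon=0$ it is assumed in addition that $A$ is not diagonal (i.e. $\alpha\ne0$ or $\gamma\neq0$) or that $X$ is finite-dimensional. 4. If $A$ is bidiagonal, i.e. $\alpha=0$ or $\gamma=0$, then $\varepsilon_n=2(\|\alpha\|_\infty+\|\gamma\|_\infty)\sin\frac{\pi}{4n+2}$. 5. This value is sharp: the shift $V$ on $\ell^2(\mathbb Z,\mathbb C)$, $(Vx)_{j+1}=x_j$, is bidiagonal with $\gamma=0$ and $\varepsilon_n(V)=2\sin\frac{\pi}{4n+2}$, and for every $0\le\delta<\varepsilon_n(V)$ it is false that $\mathrm{spec}_\varepsilon V\subset\sigma^n_{\varepsilon+\delta}(V)$ for all $\varepsilon>0$, and also false that $\mathrm{Spec}_\varepsilon V\subset\Sigma^n_{\varepsilon+\delta}(V)$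 for all $\varepsilon\ge0$. -/

import Mathlib

open scoped ENNReal

noncomputable section

namespace TauMethod

/-! ### Pseudospectra of a bounded operator on a complex normed space -/

section Pseudospectra

variable {Y : Type*} [NormedAddCommGroup Y] [NormedSpace ℂ Y]

open Classical in
/-- `‖B⁻¹‖`, with the convention `‖B⁻¹‖ = ∞` if `B` is not invertible in `L(Y)`. -/
def normInv (B : Y →L[ℂ] Y) : ℝ≥0∞ :=
  if IsUnit B then ‖Ring.inverse B‖ₑ else ⊤

/-- The open `ε`-pseudospectrum `{z : 1 / ‖(B - z I)⁻¹‖ < ε}`, where `1 / ∞ = 0`. -/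
def openPseudospectrum (ε : ℝ) (B : Y →L[ℂ] Y) : Set ℂ :=
  {z | (normInv (B - z • ContinuousLinearMap.id ℂ Y))⁻¹ < ENNReal.ofReal ε}

/-- The closed `ε`-pseudospectrum `{z : 1 / ‖(B - z I)⁻¹‖ ≤ ε}`, where `1 / ∞ = 0`.
For `ε = 0` it is the spectrum, see `closedPseudospectrum_zero`. -/
def closedPseudospectrum (ε : ℝ) (B : Y →L[ℂ] Y) : Set ℂ :=
  {z | (normInv (B - z • ContinuousLinearMap.id ℂ Y))⁻¹ ≤ ENNReal.ofReal ε}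

theorem closedPseudospectrum_zero (B : Y →L[ℂ] Y) :
    closedPseudospectrum 0 B = spectrum ℂ B := by
  ext z
  have h : B - z • ContinuousLinearMap.id ℂ Y = -(algebraMap ℂ (Y →L[ℂ] Y) z - B) := by
    rw [Algebra.algebraMap_eq_smul_one]
    simp [ContinuousLinearMap.one_def]
  have h' : IsUnit (B - z • ContinuousLinearMap.id ℂ Y) ↔
      IsUnit (algebraMap ℂ (Y →L[ℂ] Y) z - B) := by
    rw [h, IsUnit.neg_iff]
  rw [spectrum.mem_iff, ← h']
  by_cases hu : IsUnit (B - z • ContinuousLinearMap.id ℂ Y)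
  · simp only [closedPseudospectrum, normInv, Set.mem_ofPred_eq, if_pos hu]
    simp [hu]
  · simp only [closedPseudospectrum, normInv, Set.mem_ofPred_eq, if_neg hu]
    simp [hu]

/-- Complex uniform convexity (uniform c-convexity, in the sense of Globevnik). -/
def ComplexUniformlyConvex (Y : Type*) [NormedAddCommGroup Y] [NormedSpace ℂ Y] : Prop :=
  ∀ ε : ℝ, 0 < ε → ∃ δ : ℝ, 0 < δ ∧ ∀ x y : Y, ε ≤ ‖y‖ →
    (∀ ζ : ℂ, ‖ζ‖ ≤ 1 → ‖x + ζ • y‖ ≤ 1) → ‖x‖ ≤ 1 - δ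

/-- Globevnik's property: `Y` is finite-dimensional, or `Y` or its Banach space dual is complex
uniformly convex. -/
def GlobevnikProperty (Y : Type*) [NormedAddCommGroup Y] [NormedSpace ℂ Y] : Prop :=
  FiniteDimensional ℂ Y ∨ ComplexUniformlyConvex Y ∨ ComplexUniformlyConvex (StrongDual ℂ Y)

end Pseudospectra

/-! ### Operators on `E = ℓ²(ℤ, X)` and their matrices -/

/-- The space `ℓ²(ℤ, X)` of square-summable bi-infinite `X`-valued sequences. -/
abbrev E (X : Type*) [NormedAddCommGroup X] : Type _ := lp (fun _ : ℤ => X) 2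

section Operators

variable {X : Type*} [NormedAddCommGroup X] [NormedSpace ℂ X]

/-- The coordinate map `x ↦ x i` on `ℓ²(ℤ, X)`. -/
def coord (i : ℤ) : E X →L[ℂ] X :=
  LinearMap.mkContinuous
    { toFun := fun x => x i
      map_add' := fun _ _ => rfl
      map_smul' := fun _ _ => rfl }
    1 (fun x => (lp.norm_apply_le_norm two_ne_zero x i).trans_eq (one_mul _).symm)

/-- The entry `a i j ∈ L(X)` in row `i`, column `j` of the matrix representation of `A`. -/
def entry (A : E X →L[ℂ] E X) (i j : ℤ) : X →L[ℂ] X :=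
  (coord i).comp (A.comp (lp.singleContinuousLinearMap ℂ (fun _ : ℤ => X) 2 j))

theorem entry_apply (A : E X →L[ℂ] E X) (i j : ℤ) (v : X) :
    entry A i j v = A (lp.single 2 j v) i := rfl

theorem norm_entry_le (A : E X →L[ℂ] E X) (i j : ℤ) : ‖entry A i j‖ ≤ ‖A‖ := by
  refine ContinuousLinearMap.opNorm_le_bound _ (norm_nonneg _) fun v => ?_
  rw [entry_apply]
  refine (lp.norm_apply_le_norm two_ne_zero _ i).trans ((A.le_opNorm _).trans ?_)
  rw [lp.norm_single (by norm_num)]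

/-- The matrix of `A` is tridiagonal. -/
def IsTridiagonal (A : E X →L[ℂ] E X) : Prop :=
  ∀ i j : ℤ, 1 < |i - j| → entry A i j = 0

/-- The subdiagonal `α j = a (j + 1) j`. -/
def subdiag (A : E X →L[ℂ] E X) (j : ℤ) : X →L[ℂ] X := entry A (j + 1) j

/-- The superdiagonal `γ j = a (j - 1) j`. -/
def superdiag (A : E X →L[ℂ] E X) (j : ℤ) : X →L[ℂ] X := entry A (j - 1) j

/-- The norm `sup_j ‖u j‖` of a sequence of operators; it is used for bounded sequences only,
such as the diagonals of a bounded operator, see `norm_entry_le`. -/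
def supNorm (u : ℤ → (X →L[ℂ] X)) : ℝ := ⨆ j : ℤ, ‖u j‖

/-- The `n × n` principal submatrix `A_{n,k}`, with rows and columns `k + 1, …, k + n`,
as an operator on `X ^ n` with the norm `(∑ ‖x j‖ ^ 2) ^ (1 / 2)`. -/
def principalSubmatrix (n : ℕ) (k : ℤ) (A : E X →L[ℂ] E X) :
    PiLp 2 (fun _ : Fin n => X) →L[ℂ] PiLp 2 (fun _ : Fin n => X) :=
  ((PiLp.continuousLinearEquiv 2 ℂ (fun _ : Fin n => X)).symm :
      (Fin n → X) →L[ℂ] PiLp 2 (fun _ : Fin n => X)).comp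
    (ContinuousLinearMap.pi fun i : Fin n =>
      ∑ j : Fin n, (entry A (k + 1 + (i : ℕ)) (k + 1 + (j : ℕ))).comp
        (PiLp.proj 2 (fun _ : Fin n => X) j))

theorem principalSubmatrix_apply (n : ℕ) (k : ℤ) (A : E X →L[ℂ] E X)
    (x : PiLp 2 (fun _ : Fin n => X)) (i : Fin n) :
    principalSubmatrix n k A x i =
      ∑ j : Fin n, entry A (k + 1 + (i : ℕ)) (k + 1 + (j : ℕ)) (x j) := by
  simp [principalSubmatrix]

/-- `σⁿ_ε(A)`: the union over `k` of the open `ε`-pseudospectra of the `A_{n,k}`. -/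
def openTauSet (n : ℕ) (ε : ℝ) (A : E X →L[ℂ] E X) : Set ℂ :=
  ⋃ k : ℤ, openPseudospectrum ε (principalSubmatrix n k A)

/-- `Σⁿ_ε(A)`: the closure of the union over `k` of the closed `ε`-pseudospectra of the
`A_{n,k}`. -/
def closedTauSet (n : ℕ) (ε : ℝ) (A : E X →L[ℂ] E X) : Set ℂ :=
  closure (⋃ k : ℤ, closedPseudospectrum ε (principalSubmatrix n k A))

end Operators

/-! ### The penalty term -/

/-- The solutions `t ∈ [π / (2n + 1), π / (n + 2)]` of
`2 sin (t / 2) cos ((n + 1 / 2) t) + φ (1 - φ) sin ((n - 1) t) = 0`. -/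
def thetaSolutions (n : ℕ) (φ : ℝ) : Set ℝ :=
  {t | t ∈ Set.Icc (Real.pi / (2 * (n : ℝ) + 1)) (Real.pi / ((n : ℝ) + 2)) ∧
    2 * Real.sin (t / 2) * Real.cos (((n : ℝ) + 1 / 2) * t)
      + φ * (1 - φ) * Real.sin (((n : ℝ) - 1) * t) = 0}

/-- `θ_n(φ)`: the least element of `thetaSolutions n φ` (in fact the only one). -/
def theta (n : ℕ) (φ : ℝ) : ℝ := sInf (thetaSolutions n φ)

/-- The penalty `2 inf_{0 < φ < 1} √(r² / φ + s² / (1 - φ)) sin (θ_n(φ) / 2)`. -/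
def penaltyOf (n : ℕ) (r s : ℝ) : ℝ :=
  2 * ⨅ φ : Set.Ioo (0 : ℝ) 1,
    Real.sqrt (r ^ 2 / (φ : ℝ) + s ^ 2 / (1 - (φ : ℝ))) * Real.sin (theta n φ / 2)

/-- The penalty `ε_n` of the operator `A`. -/
def penalty {X : Type*} [NormedAddCommGroup X] [NormedSpace ℂ X] (n : ℕ)
    (A : E X →L[ℂ] E X) : ℝ :=
  penaltyOf n (supNorm (subdiag A)) (supNorm (superdiag A))

end TauMethod

end

namespace TauMethod

open Real Filter Topology

/-! ### The angle `θ_n(φ)` -/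

/-! The `τ` method compares `A` with its finite sections through weighted truncations. For `y = A x`
and a weight `W` living on `n` consecutive sites, applying `A_{n,k}` to the weighted window of `x`
gives the weighted window of `y` plus a commutator that contains only the off-diagonal entries times
differences of neighbouring weights (`norm_weighted_row_sq_le`). Squaring and summing over all
windows `k` turns every shifted sum into a full norm. Sections bounded below by `m` therefore make
`A` bounded below by `m` minus a penalty, which is a Rayleigh quotient of the weight
(`mul_sqrt_le_of_sections`).

The parameter `φ` comes from a weighted Cauchy-Schwarz inequality separating the two off-diagonals.
The resulting quadratic form is a discrete Dirichlet energy with end terms `φ W₁²` and `(1 - φ)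
Wₙ²`; its eigenvectors are combinations of sines, and the equation for `θ_n(φ)` is precisely the
right-hand boundary condition (`exists_weights`). The infimum over `φ` is `ε_n`.

A lower bound alone does not give invertibility. A functional vanishing on the range of `A`
restricts to a square summable sequence of functionals on `X` that solves the transposed equation.
Transposed sections inherit the lower bound because the sections are invertible, and the penalty is
symmetric in the two diagonals, so this sequence vanishes (`eq_zero_of_comp_eq_zero`). This proves
the open inclusion.

For closed pseudospectra, a point `z` off the closure has a whole disc around it on which all
section resolvents obey one common bound. Globevnik's property improves that bound strictly at the
centre, uniformly in `k` (`exists_gap_of_globevnikProperty`). In the uniformly convex cases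
Schwarz-Pick places a complex disc, spanned by the value and the derivative of a resolvent orbit, in
the unit ball; in finite dimensions compactness and the maximum principle suffice.

If one diagonal vanishes, `φ` can be pushed to an end of `(0, 1)`, which gives the explicit penalty.
For the shift, `1` is in the spectrum while every section minus `1` is bounded below by exactly this
value (`sum_sq_le_energy`), whence sharpness. -/

/-- The function whose zeros are the elements of `thetaSolutions`, with `c = φ (1 - φ)`. -/
noncomputable def thetaFun (n : ℕ) (c t : ℝ) : ℝ :=
  2 * sin (t / 2) * cos (((n : ℝ) + 1 / 2) * t) + c * sin (((n : ℝ) - 1) * t)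

theorem mem_thetaSolutions {n : ℕ} {φ t : ℝ} :
    t ∈ thetaSolutions n φ ↔
      t ∈ Set.Icc (π / (2 * (n : ℝ) + 1)) (π / ((n : ℝ) + 2)) ∧
        thetaFun n (φ * (1 - φ)) t = 0 := Iff.rfl

theorem continuous_thetaFun (n : ℕ) (c : ℝ) : Continuous (thetaFun n c) := by
  unfold thetaFun; fun_prop

theorem left_le_right {n : ℕ} (hn : 1 ≤ n) : π / (2 * (n : ℝ) + 1) ≤ π / ((n : ℝ) + 2) := by
  have : (1 : ℝ) ≤ n := by exact_mod_cast hn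
  exact div_le_div_of_nonneg_left pi_pos.le (by linarith) (by linarith)

/-- The inequalities satisfied by every point of the interval that contains `θ_n(φ)`. -/
theorem bounds_of_mem_Icc {n : ℕ} (hn : 1 ≤ n) {t : ℝ}
    (ht : t ∈ Set.Icc (π / (2 * (n : ℝ) + 1)) (π / ((n : ℝ) + 2))) :
    0 < t ∧ 3 * t ≤ π ∧ π ≤ (2 * n + 1) * t ∧ (n + 2) * t ≤ π := by
  have h1 : (1 : ℝ) ≤ n := by exact_mod_cast hn
  have ha : 0 < t := lt_of_lt_of_le (by positivity) ht.1
  have h2 := (div_le_iff₀ (by positivity : (0 : ℝ) < 2 * n + 1)).1 ht.1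
  have h3 := (le_div_iff₀ (by positivity : (0 : ℝ) < (n : ℝ) + 2)).1 ht.2
  refine ⟨ha, ?_, by linarith, by linarith⟩
  nlinarith

theorem thetaFun_left_nonneg {n : ℕ} (hn : 1 ≤ n) {c : ℝ} (hc : 0 ≤ c) :
    0 ≤ thetaFun n c (π / (2 * (n : ℝ) + 1)) := by
  have h1 : (1 : ℝ) ≤ n := by exact_mod_cast hn
  obtain ⟨h0, -, -, h4⟩ := bounds_of_mem_Icc hn ⟨le_rfl, left_le_right hn⟩
  unfold thetaFun
  have : ((n : ℝ) + 1 / 2) * (π / (2 * (n : ℝ) + 1)) = π / 2 := by field_simp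
  rw [this, cos_pi_div_two, mul_zero, zero_add]
  refine mul_nonneg hc (sin_nonneg_of_nonneg_of_le_pi (by nlinarith) (by nlinarith))

/-- At `b = π / (n + 2)` both angles reduce to multiples of `b / 2`, and the function factors as `2
cos (3b/2) (c sin (3b/2) - sin (b/2))`. The triple angle formula makes the last factor nonpositive,
since `3c ≤ 1`. -/
theorem thetaFun_right_nonpos {n : ℕ} (hn : 1 ≤ n) {c : ℝ} (hc' : c ≤ 1 / 4) :
    thetaFun n c (π / ((n : ℝ) + 2)) ≤ 0 := by
  have h1 : (1 : ℝ) ≤ n := by exact_mod_cast hn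
  obtain ⟨h0, h3, -, -⟩ := bounds_of_mem_Icc hn ⟨left_le_right hn, le_rfl⟩
  set b := π / ((n : ℝ) + 2) with hb
  have hb' : ((n : ℝ) + 2) * b = π := by rw [hb]; field_simp
  unfold thetaFun
  have e1 : ((n : ℝ) + 1 / 2) * b = π - 3 * (b / 2) := by linarith
  have e2 : ((n : ℝ) - 1) * b = π - 2 * (3 * (b / 2)) := by linarith
  rw [e1, e2, cos_pi_sub, sin_pi_sub, sin_two_mul, sin_three_mul]
  have hcos : 0 ≤ cos (3 * (b / 2)) := cos_nonneg_of_mem_Icc ⟨by linarith, by linarith⟩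
  have hsin : 0 ≤ sin (b / 2) := sin_nonneg_of_nonneg_of_le_pi (by linarith) (by linarith)
  have hs1 : sin (b / 2) ≤ 1 := sin_le_one _
  have key : c * (3 * sin (b / 2) - 4 * sin (b / 2) ^ 3) ≤ sin (b / 2) := by
    have : 0 ≤ 3 * sin (b / 2) - 4 * sin (b / 2) ^ 3 := by
      rw [← sin_three_mul]
      exact sin_nonneg_of_nonneg_of_le_pi (by linarith) (by linarith)
    have h3 : 0 ≤ sin (b / 2) ^ 3 := by positivity
    nlinarith
  nlinarith

theorem exists_thetaFun_eq_zero {n : ℕ} (hn : 1 ≤ n) {c t₀ : ℝ} (hc : 0 ≤ c)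
    (h₀ : π / (2 * (n : ℝ) + 1) ≤ t₀) (h : thetaFun n c t₀ ≤ 0) :
    ∃ t ∈ Set.Icc (π / (2 * (n : ℝ) + 1)) t₀, thetaFun n c t = 0 := by
  have := intermediate_value_Icc' h₀ (continuous_thetaFun n c).continuousOn
  obtain ⟨t, ht, h⟩ := this ⟨h, thetaFun_left_nonneg hn hc⟩
  exact ⟨t, ht, h⟩

theorem strictAntiOn_cos_div_sin {n : ℕ} (hn : 2 ≤ n) :
    StrictAntiOn (fun t => cos (((n : ℝ) + 1 / 2) * t) / sin (((n : ℝ) - 1) * t))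
      (Set.Icc (π / (2 * (n : ℝ) + 1)) (π / ((n : ℝ) + 2))) := by
  have h2 : (2 : ℝ) ≤ n := by exact_mod_cast hn
  have hpos : ∀ t ∈ Set.Icc (π / (2 * (n : ℝ) + 1)) (π / ((n : ℝ) + 2)),
      0 < sin (((n : ℝ) - 1) * t) := fun t ht => by
    obtain ⟨h0, -, -, h4⟩ := bounds_of_mem_Icc (by omega) ht
    exact sin_pos_of_pos_of_lt_pi (by nlinarith) (by nlinarith)
  refine strictAntiOn_of_deriv_neg (convex_Icc _ _) ?_ ?_
  · refine ContinuousOn.div (by fun_prop) (by fun_prop) fun t ht => (hpos t ht).ne'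
  · intro t ht
    rw [interior_Icc] at ht
    have ht' := Set.Ioo_subset_Icc_self ht
    have hs := hpos t ht'
    obtain ⟨h0, h3, h4, h5⟩ := bounds_of_mem_Icc (by omega) ht'
    have d1 : HasDerivAt (fun t => cos (((n : ℝ) + 1 / 2) * t))
        (-sin (((n : ℝ) + 1 / 2) * t) * ((n : ℝ) + 1 / 2)) t := by
      simpa using ((hasDerivAt_id t).const_mul ((n : ℝ) + 1 / 2)).cos
    have d2 : HasDerivAt (fun t => sin (((n : ℝ) - 1) * t))
        (cos (((n : ℝ) - 1) * t) * ((n : ℝ) - 1)) t := by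
      simpa using ((hasDerivAt_id t).const_mul ((n : ℝ) - 1)).sin
    rw [(d1.fun_div d2 hs.ne').deriv]
    refine div_neg_of_neg_of_pos ?_ (by positivity)
    have hsin : 0 < sin (((n : ℝ) + 1 / 2) * t) :=
      sin_pos_of_pos_of_lt_pi (by positivity) (by nlinarith)
    have hcos : 0 ≤ cos (3 * t / 2) := cos_nonneg_of_mem_Icc ⟨by linarith, by linarith⟩
    -- The two frequencies differ by `3/2`, so the numerator of the derivative splits into a
    -- multiple of `cos (3t/2)`, nonnegative because `3t ≤ π`, and a strictly signed product of
    -- sines.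
    have e : cos (3 * t / 2) = cos (((n : ℝ) + 1 / 2) * t) * cos (((n : ℝ) - 1) * t)
        + sin (((n : ℝ) + 1 / 2) * t) * sin (((n : ℝ) - 1) * t) := by
      rw [← cos_sub]; congr 1; ring
    have : -sin (((n : ℝ) + 1 / 2) * t) * ((n : ℝ) + 1 / 2) * sin (((n : ℝ) - 1) * t)
        - cos (((n : ℝ) + 1 / 2) * t) * (cos (((n : ℝ) - 1) * t) * ((n : ℝ) - 1))
        = -((n - 1) * cos (3 * t / 2))
          - 3 / 2 * (sin (((n : ℝ) + 1 / 2) * t) * sin (((n : ℝ) - 1) * t)) := by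
      rw [e]; ring
    rw [this]
    have := mul_pos hsin hs
    have := mul_nonneg (by linarith : (0 : ℝ) ≤ n - 1) hcos
    linarith

/-- After division by `sin ((n - 1) t)`, a zero is a solution of `2 sin (t/2) · H(t) = -c` with `H`
nonpositive and strictly decreasing. As `sin (t/2)` is positive and increasing, the product is
strictly decreasing. -/
theorem thetaFun_zero_unique {n : ℕ} (hn : 1 ≤ n) {c t₁ t₂ : ℝ}
    (h₁ : t₁ ∈ Set.Icc (π / (2 * (n : ℝ) + 1)) (π / ((n : ℝ) + 2)))
    (h₂ : t₂ ∈ Set.Icc (π / (2 * (n : ℝ) + 1)) (π / ((n : ℝ) + 2)))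
    (e₁ : thetaFun n c t₁ = 0) (e₂ : thetaFun n c t₂ = 0) : t₁ = t₂ := by
  wlog hlt : t₁ < t₂ generalizing t₁ t₂
  · rcases eq_or_lt_of_le (not_lt.1 hlt) with h | h
    · exact h.symm
    · exact (this h₂ h₁ e₂ e₁ h).symm
  exfalso
  rcases hn.eq_or_lt with rfl | hn2
  -- For `n = 1` the sine in the denominator vanishes identically, but the interval is the single
  -- point `π / 3`.
  · norm_num at h₁ h₂
    linarith
  have hH := strictAntiOn_cos_div_sin hn2 h₁ h₂ hlt
  have h2 : (2 : ℝ) ≤ n := by exact_mod_cast hn2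
  have aux : ∀ t ∈ Set.Icc (π / (2 * (n : ℝ) + 1)) (π / ((n : ℝ) + 2)), thetaFun n c t = 0 →
      2 * sin (t / 2) * (cos (((n : ℝ) + 1 / 2) * t) / sin (((n : ℝ) - 1) * t)) = -c := by
    intro t ht e
    obtain ⟨h0, -, -, h4⟩ := bounds_of_mem_Icc hn ht
    have hs : 0 < sin (((n : ℝ) - 1) * t) := sin_pos_of_pos_of_lt_pi (by nlinarith) (by nlinarith)
    unfold thetaFun at e
    rw [← mul_div_assoc, div_eq_iff hs.ne']
    linarith
  have a₁ := aux t₁ h₁ e₁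
  have a₂ := aux t₂ h₂ e₂
  obtain ⟨p0, p3, p4, p5⟩ := bounds_of_mem_Icc hn h₁
  obtain ⟨q0, q3, q4, q5⟩ := bounds_of_mem_Icc hn h₂
  have hle : cos (((n : ℝ) + 1 / 2) * t₁) / sin (((n : ℝ) - 1) * t₁) ≤ 0 :=
    div_nonpos_of_nonpos_of_nonneg
      (cos_nonpos_of_pi_div_two_le_of_le (by nlinarith) (by nlinarith))
      (sin_nonneg_of_nonneg_of_le_pi (by nlinarith) (by nlinarith))
  have s1 : sin (t₁ / 2) < sin (t₂ / 2) :=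
    sin_lt_sin_of_lt_of_le_pi_div_two (by linarith) (by linarith) (by linarith)
  have s0 : 0 < sin (t₁ / 2) := sin_pos_of_pos_of_lt_pi (by linarith) (by linarith)
  simp only at hH
  nlinarith

theorem mul_one_sub_mem {φ : ℝ} (hφ : φ ∈ Set.Ioo (0 : ℝ) 1) :
    0 ≤ φ * (1 - φ) ∧ φ * (1 - φ) ≤ 1 / 4 :=
  ⟨mul_nonneg hφ.1.le (by linarith [hφ.2]), by nlinarith [sq_nonneg (φ - 1 / 2)]⟩

theorem thetaSolutions_eq_singleton {n : ℕ} (hn : 1 ≤ n) {φ : ℝ} (hφ : φ ∈ Set.Ioo (0 : ℝ) 1) :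
    thetaSolutions n φ = {theta n φ} := by
  obtain ⟨hc, hc'⟩ := mul_one_sub_mem hφ
  obtain ⟨t, ht, e⟩ := exists_thetaFun_eq_zero hn hc (left_le_right hn)
    (thetaFun_right_nonpos hn hc')
  have : thetaSolutions n φ = {t} := by
    ext s
    rw [mem_thetaSolutions, Set.mem_singleton_iff]
    exact ⟨fun h => thetaFun_zero_unique hn h.1 ht h.2 e, fun h => h ▸ ⟨ht, e⟩⟩
  rw [theta, this, csInf_singleton]

theorem theta_mem {n : ℕ} (hn : 1 ≤ n) {φ : ℝ} (hφ : φ ∈ Set.Ioo (0 : ℝ) 1) :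
    theta n φ ∈ Set.Icc (π / (2 * (n : ℝ) + 1)) (π / ((n : ℝ) + 2)) ∧
      thetaFun n (φ * (1 - φ)) (theta n φ) = 0 := by
  rw [← mem_thetaSolutions, thetaSolutions_eq_singleton hn hφ]
  exact rfl

theorem theta_one_sub (n : ℕ) (φ : ℝ) : theta n (1 - φ) = theta n φ := by
  have : thetaSolutions n (1 - φ) = thetaSolutions n φ := by
    ext t
    rw [mem_thetaSolutions, mem_thetaSolutions, sub_sub_cancel, mul_comm (1 - φ)]
  rw [theta, this, theta]

theorem theta_le_of_thetaFun_nonpos {n : ℕ} (hn : 1 ≤ n) {φ t₀ : ℝ} (hφ : φ ∈ Set.Ioo (0 : ℝ) 1)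
    (ht₀ : t₀ ∈ Set.Icc (π / (2 * (n : ℝ) + 1)) (π / ((n : ℝ) + 2)))
    (h : thetaFun n (φ * (1 - φ)) t₀ ≤ 0) : theta n φ ≤ t₀ := by
  obtain ⟨t, ht, e⟩ := exists_thetaFun_eq_zero hn (mul_one_sub_mem hφ).1 ht₀.1 h
  obtain ⟨hm, e'⟩ := theta_mem hn hφ
  rw [thetaFun_zero_unique hn hm ⟨ht.1, ht.2.trans ht₀.2⟩ e' e]
  exact ht.2

theorem Ioo_mem_nhdsLT_one : Set.Ioo (0 : ℝ) 1 ∈ 𝓝[<] (1 : ℝ) :=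
  Ioo_mem_nhdsLT zero_lt_one

theorem tendsto_theta {n : ℕ} (hn : 1 ≤ n) :
    Tendsto (theta n) (𝓝[<] 1) (𝓝 (π / (2 * (n : ℝ) + 1))) := by
  have h1 : (1 : ℝ) ≤ n := by exact_mod_cast hn
  rw [tendsto_order]
  constructor
  · intro a ha
    filter_upwards [Ioo_mem_nhdsLT_one] with φ hφ
    exact ha.trans_le (theta_mem hn hφ).1.1
  · intro b hb
    rcases hn.eq_or_lt with rfl | hn2
    · filter_upwards [Ioo_mem_nhdsLT_one] with φ hφ
      have := (theta_mem le_rfl hφ).1.2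
      norm_num at this hb
      linarith
    have h2 : (2 : ℝ) ≤ n := by exact_mod_cast hn2
    have hab : π / (2 * (n : ℝ) + 1) < π / ((n : ℝ) + 2) :=
      div_lt_div_of_pos_left pi_pos (by linarith) (by linarith)
    obtain ⟨t₀, ht₀, ht₀'⟩ := exists_between (lt_min hab hb)
    rw [lt_min_iff] at ht₀'
    have hmem : t₀ ∈ Set.Icc (π / (2 * (n : ℝ) + 1)) (π / ((n : ℝ) + 2)) := ⟨ht₀.le, ht₀'.1.le⟩
    obtain ⟨p0, p3, p4, p5⟩ := bounds_of_mem_Icc hn hmem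
    have p4' : π < (2 * n + 1) * t₀ := by
      have := (div_lt_iff₀ (by positivity : (0 : ℝ) < 2 * n + 1)).1 ht₀
      linarith
    -- At the limit value `φ = 1` the second term drops out and the cosine is already negative to
    -- the right of `π / (2n + 1)`; continuity in `φ` then traps the zero to the left of `t₀`.
    have hneg : thetaFun n (1 * (1 - 1)) t₀ < 0 := by
      unfold thetaFun
      have hs : 0 < sin (t₀ / 2) := sin_pos_of_pos_of_lt_pi (by linarith) (by linarith)
      have hc : cos (((n : ℝ) + 1 / 2) * t₀) < 0 :=
        cos_neg_of_pi_div_two_lt_of_lt (by nlinarith) (by nlinarith)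
      nlinarith
    have hcont : Continuous fun φ : ℝ => thetaFun n (φ * (1 - φ)) t₀ := by
      unfold thetaFun; fun_prop
    have hev : ∀ᶠ φ in 𝓝[<] (1 : ℝ), thetaFun n (φ * (1 - φ)) t₀ < 0 :=
      (hcont.tendsto 1).mono_left nhdsWithin_le_nhds |>.eventually_lt_const hneg
    filter_upwards [Ioo_mem_nhdsLT_one, hev] with φ hφ hlt
    exact (theta_le_of_thetaFun_nonpos hn hφ hmem hlt.le).trans_lt ht₀'.2

/-! ### The weights -/

/-- Summation by parts for the energy of a three-term recurrence sequence with the boundary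
condition `w 0 = (1 - φ) w 1`. -/
theorem energy_eq_of_recurrence {m : ℕ} {w : ℕ → ℝ} {c φ : ℝ}
    (hw : ∀ i, w (i + 2) = 2 * c * w (i + 1) - w i)
    (h0 : w 0 = (1 - φ) * w 1) :
    φ * w 1 ^ 2 + ∑ i ∈ Finset.range m, (w (i + 2) - w (i + 1)) ^ 2 =
      (2 - 2 * c) * ∑ i ∈ Finset.range (m + 1), w (i + 1) ^ 2
        + w (m + 1) * (w (m + 2) - w (m + 1)) := by
  induction m with
  | zero =>
    simp only [Finset.range_zero, Finset.sum_empty, zero_add, Finset.sum_range_one]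
    rw [hw 0, h0]; ring_nf
  | succ m ih =>
    rw [Finset.sum_range_succ, ← add_assoc, ih, Finset.sum_range_succ (n := m + 1)]
    have := hw (m + 1)
    simp only [show m + 1 + 2 = m + 3 from rfl, show m + 1 + 1 = m + 2 from rfl] at this ⊢
    rw [this]; ring

/-- The weights of the `τ` method, supported in `{1, …, n}`: an eigenvector of the energy form. -/
theorem exists_weights {n : ℕ} (hn : 1 ≤ n) {φ : ℝ} (hφ : φ ∈ Set.Ioo (0 : ℝ) 1) :
    ∃ W : ℕ → ℝ, W 0 = 0 ∧ W (n + 1) = 0 ∧ 0 < ∑ i ∈ Finset.range n, W (i + 1) ^ 2 ∧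
      φ * ∑ i ∈ Finset.range n, (W i - W (i + 1)) ^ 2
        + (1 - φ) * ∑ i ∈ Finset.range n, (W (i + 2) - W (i + 1)) ^ 2 =
      (2 * sin (theta n φ / 2)) ^ 2 * ∑ i ∈ Finset.range n, W (i + 1) ^ 2 := by
  obtain ⟨hm, he⟩ := theta_mem hn hφ
  obtain ⟨p0, p3, -, -⟩ := bounds_of_mem_Icc hn hm
  set θ := theta n φ
  obtain ⟨m, rfl⟩ : ∃ m, n = m + 1 := ⟨n - 1, by omega⟩
  -- The solution of the recurrence with the left boundary condition `w 0 = (1 - φ) w 1`, which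
  -- encodes the end term `φ w₁²` of the energy.
  set w : ℕ → ℝ := fun i => sin (i * θ) - (1 - φ) * sin ((i - 1) * θ) with hwdef
  have hsin : 0 < sin θ := sin_pos_of_pos_of_lt_pi p0 (by linarith)
  have w1 : w 1 = sin θ := by simp [hwdef]
  have w0 : w 0 = (1 - φ) * w 1 := by rw [w1]; simp [hwdef]
  have hrec : ∀ i, w (i + 2) = 2 * cos θ * w (i + 1) - w i := by
    intro i
    have key : ∀ x : ℝ, sin (x + 2 * θ) = 2 * cos θ * sin (x + θ) - sin x := by
      intro x
      rw [sin_add, sin_add, sin_two_mul, cos_two_mul]; ring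
    have k1 := key (i * θ)
    have k2 := key ((i - 1) * θ)
    simp only [hwdef]
    push_cast
    rw [show ((i : ℝ) + 2) * θ = i * θ + 2 * θ by ring,
      show ((i : ℝ) + 2 - 1) * θ = (i - 1) * θ + 2 * θ by ring,
      show ((i : ℝ) + 1) * θ = i * θ + θ by ring,
      show ((i : ℝ) + 1 - 1) * θ = (i - 1) * θ + θ by ring, k1, k2]
    ring
  -- The mirror-image boundary condition at the right end; it is equivalent to the defining equation
  -- of `θ_n(φ)`.
  have hend : w (m + 2) = φ * w (m + 1) := by
    unfold thetaFun at he
    have e2 : 2 * sin (θ / 2) * cos ((((m + 1 : ℕ) : ℝ) + 1 / 2) * θ) =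
        sin (((m + 1 : ℕ) + 1 : ℝ) * θ) - sin (((m + 1 : ℕ) : ℝ) * θ) := by
      rw [sin_sub_sin]; ring_nf
    rw [e2] at he
    simp only [hwdef]
    push_cast at he ⊢
    ring_nf at he ⊢
    linarith
  have hen := energy_eq_of_recurrence (m := m) hrec w0
  rw [hend] at hen
  -- The values of `w` at `0` and `m + 2` only encode boundary conditions; the actual weights are
  -- zero there.
  set W : ℕ → ℝ := fun i => if 1 ≤ i ∧ i ≤ m + 1 then w i else 0 with hW
  have W0 : W 0 = 0 := by simp [hW]
  have Wn : W (m + 2) = 0 := by simp [hW]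
  have Wi : ∀ i, i < m + 1 → W (i + 1) = w (i + 1) := fun i hi => by
    simp only [hW]; rw [if_pos (by omega)]
  have S1 : ∑ i ∈ Finset.range (m + 1), W (i + 1) ^ 2
      = ∑ i ∈ Finset.range (m + 1), w (i + 1) ^ 2 :=
    Finset.sum_congr rfl fun i hi => by rw [Wi i (Finset.mem_range.1 hi)]
  have S2 : ∑ i ∈ Finset.range (m + 1), (W i - W (i + 1)) ^ 2
      = ∑ i ∈ Finset.range m, (w (i + 2) - w (i + 1)) ^ 2 + w 1 ^ 2 := by
    rw [Finset.sum_range_succ', W0, zero_add, Wi 0 (by omega)]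
    simp only [zero_add, zero_sub, neg_sq]
    congr 1
    refine Finset.sum_congr rfl fun i hi => ?_
    have := Finset.mem_range.1 hi
    rw [Wi i (by omega), Wi (i + 1) (by omega)]; ring
  have S3 : ∑ i ∈ Finset.range (m + 1), (W (i + 2) - W (i + 1)) ^ 2
      = ∑ i ∈ Finset.range m, (w (i + 2) - w (i + 1)) ^ 2 + w (m + 1) ^ 2 := by
    rw [Finset.sum_range_succ, Wn, Wi m (by omega)]
    simp only [zero_sub, neg_sq]
    congr 1
    refine Finset.sum_congr rfl fun i hi => ?_
    have := Finset.mem_range.1 hi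
    rw [Wi i (by omega), Wi (i + 1) (by omega)]
  refine ⟨W, W0, Wn, ?_, ?_⟩
  · rw [S1]
    refine Finset.sum_pos' (fun i _ => sq_nonneg _) ⟨0, by simp, ?_⟩
    rw [zero_add, w1]; positivity
  · have hcos : (2 * sin (θ / 2)) ^ 2 = 2 - 2 * cos θ := by
      have := cos_two_mul (θ / 2)
      rw [mul_div_cancel₀ _ (two_ne_zero)] at this
      have h2 := sin_sq_add_cos_sq (θ / 2)
      nlinarith
    rw [S1, S2, S3, hcos]
    linear_combination hen

/-! ### The penalty -/

theorem sin_half_theta_bounds {n : ℕ} (hn : 1 ≤ n) {φ : ℝ} (hφ : φ ∈ Set.Ioo (0 : ℝ) 1) :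
    0 < sin (π / (4 * n + 2)) ∧ sin (π / (4 * n + 2)) ≤ sin (theta n φ / 2) := by
  have h1 : (1 : ℝ) ≤ n := by exact_mod_cast hn
  obtain ⟨hm, -⟩ := theta_mem hn hφ
  obtain ⟨p0, p3, -, -⟩ := bounds_of_mem_Icc hn hm
  have e : π / (4 * n + 2) = π / (2 * (n : ℝ) + 1) / 2 := by field_simp; ring
  have hp : 0 < π / (4 * n + 2) := by positivity
  have hle : π / (4 * n + 2) ≤ theta n φ / 2 := by rw [e]; linarith [hm.1]
  exact ⟨sin_pos_of_pos_of_lt_pi hp (by linarith),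
    sin_le_sin_of_le_of_le_pi_div_two (by linarith) (by linarith) hle⟩

theorem penalty_term_nonneg {n : ℕ} (hn : 1 ≤ n) (r s : ℝ) (φ : Set.Ioo (0 : ℝ) 1) :
    0 ≤ sqrt (r ^ 2 / (φ : ℝ) + s ^ 2 / (1 - (φ : ℝ))) * sin (theta n φ / 2) := by
  obtain ⟨h0, h1⟩ := sin_half_theta_bounds hn φ.2
  exact mul_nonneg (sqrt_nonneg _) (h0.le.trans h1)

theorem bddBelow_penalty_terms {n : ℕ} (hn : 1 ≤ n) (r s : ℝ) :
    BddBelow (Set.range fun φ : Set.Ioo (0 : ℝ) 1 =>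
      sqrt (r ^ 2 / (φ : ℝ) + s ^ 2 / (1 - (φ : ℝ))) * sin (theta n φ / 2)) :=
  ⟨0, by rintro _ ⟨φ, rfl⟩; exact penalty_term_nonneg hn r s φ⟩

instance nonempty_Ioo_zero_one : Nonempty (Set.Ioo (0 : ℝ) 1) := ⟨⟨1 / 2, by norm_num⟩⟩

theorem penaltyOf_nonneg {n : ℕ} (hn : 1 ≤ n) (r s : ℝ) : 0 ≤ penaltyOf n r s :=
  mul_nonneg zero_le_two (le_ciInf fun φ => penalty_term_nonneg hn r s φ)

/-- The substitution `φ ↦ 1 - φ` swaps the two norms and fixes `θ_n`. This is what lets the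
transposed matrix have the same penalty. -/
theorem penaltyOf_comm (n : ℕ) (r s : ℝ) : penaltyOf n r s = penaltyOf n s r := by
  unfold penaltyOf
  let e : Set.Ioo (0 : ℝ) 1 ≃ Set.Ioo (0 : ℝ) 1 :=
    { toFun := fun φ => ⟨1 - φ, by linarith [φ.2.2], by linarith [φ.2.1]⟩
      invFun := fun φ => ⟨1 - φ, by linarith [φ.2.2], by linarith [φ.2.1]⟩
      left_inv := fun φ => by simp
      right_inv := fun φ => by simp }
  rw [← e.iInf_comp]
  congr 2
  ext φ
  simp only [e, Equiv.coe_fn_mk, theta_one_sub, sub_sub_cancel]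
  rw [add_comm]

theorem le_penaltyOf {n : ℕ} (hn : 1 ≤ n) (r s : ℝ) :
    2 * r * sin (π / (4 * n + 2)) ≤ penaltyOf n r s := by
  unfold penaltyOf
  rw [mul_assoc]
  refine mul_le_mul_of_nonneg_left (le_ciInf fun φ => ?_) zero_le_two
  obtain ⟨h0, h1⟩ := sin_half_theta_bounds hn φ.2
  refine mul_le_mul ?_ h1 h0.le (sqrt_nonneg _)
  refine le_sqrt_of_sq_le ?_
  have hp := φ.2.1
  have hq := φ.2.2
  have h2 : r ^ 2 ≤ r ^ 2 / (φ : ℝ) := by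
    rw [le_div_iff₀ hp]; nlinarith [sq_nonneg r]
  have h3 : 0 ≤ s ^ 2 / (1 - (φ : ℝ)) := div_nonneg (sq_nonneg _) (by linarith)
  linarith

theorem penaltyOf_pos {n : ℕ} (hn : 1 ≤ n) {r s : ℝ} (hr : 0 ≤ r) (hs : 0 ≤ s)
    (h : r ≠ 0 ∨ s ≠ 0) : 0 < penaltyOf n r s := by
  have hsin := (sin_half_theta_bounds hn (φ := 1 / 2) (by norm_num)).1
  rcases h with h | h
  · exact lt_of_lt_of_le (by positivity) (le_penaltyOf hn r s)
  · rw [penaltyOf_comm]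
    exact lt_of_lt_of_le (by positivity) (le_penaltyOf hn s r)

/-- With `s = 0` nothing blows up as `φ → 1`, and there `θ_n(φ)` tends to the left endpoint; the
limit equals the general lower bound `le_penaltyOf`. -/
theorem penaltyOf_zero_right {n : ℕ} (hn : 1 ≤ n) {r : ℝ} (hr : 0 ≤ r) :
    penaltyOf n r 0 = 2 * r * sin (π / (4 * n + 2)) := by
  refine le_antisymm ?_ (le_penaltyOf hn r 0)
  have hT : Tendsto (fun φ : ℝ => 2 * (sqrt (r ^ 2 / φ + 0 ^ 2 / (1 - φ)) * sin (theta n φ / 2)))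
      (𝓝[<] 1) (𝓝 (2 * (sqrt (r ^ 2 / 1) * sin (π / (2 * (n : ℝ) + 1) / 2)))) := by
    have h1 : Tendsto (fun φ : ℝ => φ) (𝓝[<] 1) (𝓝 1) := tendsto_id.mono_left nhdsWithin_le_nhds
    simp only [ne_eq, OfNat.ofNat_ne_zero, not_false_eq_true, zero_pow, zero_div, add_zero]
    exact (((tendsto_const_nhds.div h1 one_ne_zero).sqrt).mul
      ((continuous_sin.tendsto _).comp ((tendsto_theta hn).div_const 2))).const_mul 2
  have e : 2 * (sqrt (r ^ 2 / 1) * sin (π / (2 * (n : ℝ) + 1) / 2))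
      = 2 * r * sin (π / (4 * n + 2)) := by
    rw [div_one, sqrt_sq hr, div_div, mul_assoc]; congr 4; ring
  rw [e] at hT
  refine ge_of_tendsto hT ?_
  filter_upwards [Ioo_mem_nhdsLT_one] with φ hφ
  exact mul_le_mul_of_nonneg_left (ciInf_le (bddBelow_penalty_terms hn r 0) ⟨φ, hφ⟩) zero_le_two

theorem mul_le_add_penaltyOf {n : ℕ} {r s m x y : ℝ} (hx : 0 ≤ x)
    (h : ∀ φ ∈ Set.Ioo (0 : ℝ) 1,
      m * x ≤ y + 2 * (sqrt (r ^ 2 / φ + s ^ 2 / (1 - φ)) * sin (theta n φ / 2)) * x) :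
    m * x ≤ y + penaltyOf n r s * x := by
  rcases hx.eq_or_lt with rfl | hx
  · simpa using h (1 / 2) (by norm_num)
  have : (m - y / x) / 2 ≤ ⨅ φ : Set.Ioo (0 : ℝ) 1,
      sqrt (r ^ 2 / (φ : ℝ) + s ^ 2 / (1 - (φ : ℝ))) * sin (theta n φ / 2) := by
    refine le_ciInf fun φ => ?_
    have h1 := h φ φ.2
    rw [← div_le_div_iff_of_pos_right hx] at h1
    have : m * x / x = m := by field_simp
    rw [this, add_div, mul_div_cancel_right₀ _ hx.ne'] at h1
    linarith
  unfold penaltyOf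
  have h2 : m - y / x ≤ 2 * ⨅ φ : Set.Ioo (0 : ℝ) 1,
      sqrt (r ^ 2 / (φ : ℝ) + s ^ 2 / (1 - (φ : ℝ))) * sin (theta n φ / 2) := by linarith
  have h3 := mul_le_mul_of_nonneg_right h2 hx.le
  rw [sub_mul, div_mul_cancel₀ _ hx.ne'] at h3
  linarith

end TauMethod

namespace TauMethod

/-! ### The `τ` method for sequences -/

/-- The right-hand side is minimal at `t = b / a`, with value `(a + b)²`; enlarging both by `η`
avoids a zero denominator or a zero `t`. Keeping `t` free until here allows the squared estimates to
be summed over `k` first. -/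
theorem le_add_sq_of_forall_le {P a b : ℝ} (ha : 0 ≤ a) (hb : 0 ≤ b)
    (h : ∀ t : ℝ, 0 < t → P ≤ (1 + t) * a ^ 2 + (1 + t⁻¹) * b ^ 2) : P ≤ (a + b) ^ 2 := by
  have key : ∀ η : ℝ, 0 < η → P ≤ (a + b + 2 * η) ^ 2 := by
    intro η hη
    have ha' : 0 < a + η := by linarith
    have hb' : 0 < b + η := by linarith
    have h1 := h ((b + η) / (a + η)) (by positivity)
    have e : (1 + (b + η) / (a + η)) * (a + η) ^ 2 + (1 + ((b + η) / (a + η))⁻¹) * (b + η) ^ 2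
        = (a + b + 2 * η) ^ 2 := by
      field_simp; ring
    rw [← e]
    refine h1.trans (add_le_add (mul_le_mul_of_nonneg_left ?_ (by positivity))
      (mul_le_mul_of_nonneg_left ?_ (by positivity)))
    · nlinarith
    · nlinarith
  have hc : Continuous fun η : ℝ => (a + b + 2 * η) ^ 2 := by fun_prop
  have ht : Filter.Tendsto (fun η : ℝ => (a + b + 2 * η) ^ 2) (nhdsWithin 0 (Set.Ioi 0))
      (nhds ((a + b + 2 * 0) ^ 2)) := (hc.tendsto 0).mono_left nhdsWithin_le_nhds
  rw [mul_zero, add_zero] at ht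
  refine ge_of_tendsto ht ?_
  filter_upwards [self_mem_nhdsWithin] with η hη using key η hη

/-- Cauchy-Schwarz for the pairs `(r/√φ, s/√(1-φ))` and `(√φ A, √(1-φ) B)`. -/
theorem add_mul_sq_le {r s φ A B : ℝ} (hφ : φ ∈ Set.Ioo (0 : ℝ) 1) :
    (r * A + s * B) ^ 2 ≤ (r ^ 2 / φ + s ^ 2 / (1 - φ)) * (φ * A ^ 2 + (1 - φ) * B ^ 2) := by
  have h0 := hφ.1
  have h1 : 0 < 1 - φ := by linarith [hφ.2]
  rw [div_add_div _ _ h0.ne' h1.ne', div_mul_eq_mul_div, le_div_iff₀ (by positivity)]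
  nlinarith [sq_nonneg ((1 - φ) * r * B - φ * s * A)]

theorem norm_add_sq_le_mul {Y : Type*} [SeminormedAddCommGroup Y] (u v : Y) {t : ℝ} (ht : 0 < t) :
    ‖u + v‖ ^ 2 ≤ (1 + t) * ‖u‖ ^ 2 + (1 + t⁻¹) * ‖v‖ ^ 2 := by
  have h1 : ‖u + v‖ ^ 2 ≤ (‖u‖ + ‖v‖) ^ 2 :=
    pow_le_pow_left₀ (norm_nonneg _) (norm_add_le u v) 2
  have h2 : (1 + t) * ‖u‖ ^ 2 + (1 + t⁻¹) * ‖v‖ ^ 2 - (‖u‖ + ‖v‖) ^ 2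
      = t⁻¹ * (t * ‖u‖ - ‖v‖) ^ 2 := by
    field_simp; ring
  have h3 : 0 ≤ t⁻¹ * (t * ‖u‖ - ‖v‖) ^ 2 := by positivity
  linarith

section Core

variable {Y : Type*} [NormedAddCommGroup Y] [NormedSpace ℂ Y]

/-- A row of a finite section of a tridiagonal matrix, applied to a weighted sequence. -/
theorem sum_section_row {n : ℕ} {b : ℤ → ℤ → (Y →L[ℂ] Y)}
    (hb : ∀ i j : ℤ, 1 < |i - j| → b i j = 0) {W : ℕ → ℝ} (W0 : W 0 = 0) (Wn : W (n + 1) = 0)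
    (x : ℤ → Y) (k : ℤ) {i : ℕ} (hi : i < n) :
    ∑ j : Fin n, b (k + 1 + i) (k + 1 + (j : ℕ)) ((W (j + 1) : ℂ) • x (k + 1 + (j : ℕ))) =
      (W i : ℂ) • b (k + 1 + i) (k + 1 + i - 1) (x (k + 1 + i - 1))
        + (W (i + 1) : ℂ) • b (k + 1 + i) (k + 1 + i) (x (k + 1 + i))
        + (W (i + 2) : ℂ) • b (k + 1 + i) (k + 1 + i + 1) (x (k + 1 + i + 1)) := by
  -- Indexing the weights from `0` to `n + 1` adds two vanishing terms, so the first and last rows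
  -- also have all three neighbours.
  set g : ℕ → Y := fun j => (W j : ℂ) • b (k + 1 + i) (k + j) (x (k + j)) with hg
  have e1 : ∑ j : Fin n, b (k + 1 + i) (k + 1 + (j : ℕ)) ((W (j + 1) : ℂ) • x (k + 1 + (j : ℕ)))
      = ∑ j ∈ Finset.range (n + 2), g j := by
    rw [Finset.sum_range_succ, Finset.sum_range_succ']
    have g0 : g 0 = 0 := by simp [hg, W0]
    have gn : g (n + 1) = 0 := by simp [hg, Wn]
    rw [g0, gn, add_zero, add_zero, Finset.sum_range]
    refine Finset.sum_congr rfl fun j _ => ?_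
    simp only [hg, map_smul]
    push_cast
    rw [show k + ((j : ℤ) + 1) = k + 1 + j by ring]
  have e2 : ∑ j ∈ Finset.range (n + 2), g j = ∑ j ∈ {i, i + 1, i + 2}, g j := by
    symm
    refine Finset.sum_subset ?_ fun j _ hj' => ?_
    · intro j hj
      simp only [Finset.mem_insert, Finset.mem_singleton] at hj
      rw [Finset.mem_range]; omega
    · simp only [Finset.mem_insert, Finset.mem_singleton, not_or] at hj'
      have : b (k + 1 + i) (k + j) = 0 := by
        refine hb _ _ ?_
        rw [lt_abs]; omega
      simp [hg, this]
  rw [e1, e2, Finset.sum_insert (by simp), Finset.sum_insert (by simp), Finset.sum_singleton,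
    ← add_assoc]
  simp only [hg]
  push_cast
  rw [show k + ((i : ℤ) + 1) = k + 1 + i by ring, show k + ((i : ℤ) + 2) = k + 1 + i + 1 by ring,
    show k + (i : ℤ) = k + 1 + i - 1 by ring]

/-- The commutator identity `w₀ p + w₁ d + w₂ q = w₁ (p + d + q) + (w₀ - w₁) p + (w₂ - w₁) q`: the
diagonal term `d` leaves no error. -/
theorem norm_weighted_row_sq_le {r s φ t : ℝ} (hφ : φ ∈ Set.Ioo (0 : ℝ) 1)
    (ht : 0 < t) (w₀ w₁ w₂ : ℝ) {p d q : Y} {P Q : ℝ} (hp : ‖p‖ ≤ r * P) (hq : ‖q‖ ≤ s * Q) :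
    ‖(w₀ : ℂ) • p + (w₁ : ℂ) • d + (w₂ : ℂ) • q‖ ^ 2 ≤
      (1 + t) * (w₁ ^ 2 * ‖p + d + q‖ ^ 2) + (1 + t⁻¹) * ((r ^ 2 / φ + s ^ 2 / (1 - φ)) *
        (φ * (w₀ - w₁) ^ 2 * P ^ 2 + (1 - φ) * (w₂ - w₁) ^ 2 * Q ^ 2)) := by
  have e : (w₀ : ℂ) • p + (w₁ : ℂ) • d + (w₂ : ℂ) • q
      = (w₁ : ℂ) • (p + d + q) + (((w₀ - w₁ : ℝ) : ℂ) • p + ((w₂ - w₁ : ℝ) : ℂ) • q) := by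
    push_cast; module
  rw [e]
  refine (norm_add_sq_le_mul _ _ ht).trans ?_
  have h1 : ‖(w₁ : ℂ) • (p + d + q)‖ ^ 2 = w₁ ^ 2 * ‖p + d + q‖ ^ 2 := by
    rw [norm_smul, mul_pow, Complex.norm_real, Real.norm_eq_abs, sq_abs]
  have h2 : ‖((w₀ - w₁ : ℝ) : ℂ) • p + ((w₂ - w₁ : ℝ) : ℂ) • q‖
      ≤ r * (|w₀ - w₁| * P) + s * (|w₂ - w₁| * Q) := by
    refine (norm_add_le _ _).trans ?_
    rw [norm_smul, norm_smul, Complex.norm_real, Complex.norm_real, Real.norm_eq_abs,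
      Real.norm_eq_abs]
    have := mul_le_mul_of_nonneg_left hp (abs_nonneg (w₀ - w₁))
    have := mul_le_mul_of_nonneg_left hq (abs_nonneg (w₂ - w₁))
    linarith
  have h3 := (pow_le_pow_left₀ (norm_nonneg _) h2 2).trans (add_mul_sq_le hφ)
  rw [mul_pow, mul_pow, sq_abs, sq_abs] at h3
  rw [h1]
  have h4 : 0 ≤ 1 + t⁻¹ := by positivity
  have := mul_le_mul_of_nonneg_left h3 h4
  linarith

theorem hasSum_sum_shift {f : ℤ → ℝ} {S : ℝ} (hf : HasSum f S) (n : ℕ) (c : ℕ → ℝ) (d : ℤ) :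
    HasSum (fun k : ℤ => ∑ i ∈ Finset.range n, c i * f (k + 1 + i + d))
      ((∑ i ∈ Finset.range n, c i) * S) := by
  rw [Finset.sum_mul]
  refine hasSum_sum fun i _ => HasSum.mul_left _ ?_
  simpa [Function.comp_def, add_assoc] using (Equiv.addRight (1 + (i : ℤ) + d)).hasSum_iff.2 hf

/-- If all finite sections of a tridiagonal matrix are bounded below by `m`, then the matrix is
bounded below by `m` minus the penalty. -/
theorem mul_sqrt_le_of_sections {n : ℕ} (hn : 1 ≤ n) {b : ℤ → ℤ → (Y →L[ℂ] Y)}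
    (hb : ∀ i j : ℤ, 1 < |i - j| → b i j = 0) {r s m : ℝ} (hr : ∀ j, ‖b (j + 1) j‖ ≤ r)
    (hs : ∀ j, ‖b (j - 1) j‖ ≤ s)
    (hsec : ∀ (k : ℤ) (v : Fin n → Y), m ^ 2 * ∑ i, ‖v i‖ ^ 2 ≤
      ∑ i : Fin n, ‖∑ j : Fin n, b (k + 1 + (i : ℕ)) (k + 1 + (j : ℕ)) (v j)‖ ^ 2)
    {x y : ℤ → Y} {X Z : ℝ} (hx : HasSum (fun i => ‖x i‖ ^ 2) X)
    (hy : ∀ i, y i = b i (i - 1) (x (i - 1)) + b i i (x i) + b i (i + 1) (x (i + 1)))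
    (hz : HasSum (fun i => ‖y i‖ ^ 2) Z) :
    m * √X ≤ √Z + penaltyOf n r s * √X := by
  have X0 : 0 ≤ X := hx.nonneg fun i => sq_nonneg _
  have Z0 : 0 ≤ Z := hz.nonneg fun i => sq_nonneg _
  refine mul_le_add_penaltyOf (Real.sqrt_nonneg _) fun φ hφ => ?_
  obtain ⟨W, W0, Wn, W_pos, hW⟩ := exists_weights hn hφ
  set C := r ^ 2 / φ + s ^ 2 / (1 - φ) with hC
  have C0 : 0 ≤ C :=
    add_nonneg (div_nonneg (sq_nonneg _) hφ.1.le)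
      (div_nonneg (sq_nonneg _) (by linarith [hφ.2]))
  set S := ∑ i ∈ Finset.range n, W (i + 1) ^ 2 with hS
  set q := 2 * Real.sin (theta n φ / 2) with hq
  have q0 : 0 ≤ q := by
    obtain ⟨h0, h1⟩ := sin_half_theta_bounds hn hφ
    linarith
  have main : ∀ t : ℝ, 0 < t → m ^ 2 * X ≤ (1 + t) * √Z ^ 2 + (1 + t⁻¹) * (√C * q * √X) ^ 2 := by
    intro t ht
    have hk : ∀ k : ℤ, m ^ 2 * ∑ i ∈ Finset.range n, W (i + 1) ^ 2 * ‖x (k + 1 + i + 0)‖ ^ 2 ≤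
        (1 + t) * ∑ i ∈ Finset.range n, W (i + 1) ^ 2 * ‖y (k + 1 + i + 0)‖ ^ 2
        + (1 + t⁻¹) * (C *
          (∑ i ∈ Finset.range n, φ * (W i - W (i + 1)) ^ 2 * ‖x (k + 1 + i + -1)‖ ^ 2
          + ∑ i ∈ Finset.range n,
            (1 - φ) * (W (i + 2) - W (i + 1)) ^ 2 * ‖x (k + 1 + i + 1)‖ ^ 2)) := by
      intro k
      have h := hsec k fun j => (W (j + 1) : ℂ) • x (k + 1 + (j : ℕ))
      have e1 : ∑ i : Fin n, ‖(W (i + 1) : ℂ) • x (k + 1 + (i : ℕ))‖ ^ 2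
          = ∑ i ∈ Finset.range n, W (i + 1) ^ 2 * ‖x (k + 1 + i + 0)‖ ^ 2 := by
        rw [Finset.sum_range]
        refine Finset.sum_congr rfl fun i _ => ?_
        rw [norm_smul, mul_pow, Complex.norm_real, Real.norm_eq_abs, sq_abs, add_zero]
      rw [e1] at h
      refine h.trans ?_
      rw [← Finset.sum_add_distrib, Finset.mul_sum, Finset.mul_sum, Finset.mul_sum,
        ← Finset.sum_add_distrib, Finset.sum_range]
      refine Finset.sum_le_sum fun i _ => ?_
      rw [sum_section_row hb W0 Wn x k i.2, add_zero, hy]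
      refine norm_weighted_row_sq_le hφ ht _ _ _ ?_ ?_
      · have := hr (k + 1 + (i : ℕ) - 1)
        rw [sub_add_cancel] at this
        rw [← sub_eq_add_neg]
        exact ContinuousLinearMap.le_of_opNorm_le _ this _
      · have := hs (k + 1 + (i : ℕ) + 1)
        rw [add_sub_cancel_right] at this
        exact ContinuousLinearMap.le_of_opNorm_le _ this _
    -- Over all `k`, each site passes through each position of the window once, so every sum factors
    -- into a sum over the weights times a full norm squared.
    have h := hasSum_le hk ((hasSum_sum_shift hx n (fun i => W (i + 1) ^ 2) 0).mul_left _)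
      (((hasSum_sum_shift hz n (fun i => W (i + 1) ^ 2) 0).mul_left _).add
        ((((hasSum_sum_shift hx n (fun i => φ * (W i - W (i + 1)) ^ 2) (-1)).add
          (hasSum_sum_shift hx n (fun i => (1 - φ) * (W (i + 2) - W (i + 1)) ^ 2) 1)).mul_left
            C).mul_left _))
    rw [← add_mul, ← Finset.mul_sum, ← Finset.mul_sum, hW, ← hS] at h
    rw [mul_pow, mul_pow, Real.sq_sqrt Z0, Real.sq_sqrt X0, Real.sq_sqrt C0]
    refine le_of_mul_le_mul_left ?_ W_pos
    calc S * (m ^ 2 * X) = m ^ 2 * (S * X) := by ring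
      _ ≤ _ := h
      _ = _ := by ring
  have h := le_add_sq_of_forall_le (Real.sqrt_nonneg Z) (by positivity) main
  have h2 : m * √X ≤ √Z + √C * q * √X := by
    refine abs_le_of_sq_le_sq' ?_ (by positivity) |>.2
    rwa [mul_pow, Real.sq_sqrt X0]
  refine h2.trans_eq ?_
  rw [hq]; ring

end Core

end TauMethod

namespace TauMethod

/-! ### Lower bounds and invertibility -/

section LowerBounds

variable {Y : Type*} [NormedAddCommGroup Y] [NormedSpace ℂ Y]

theorem inverse_apply_apply {B : Y →L[ℂ] Y} (hB : IsUnit B) (x : Y) : Ring.inverse B (B x) = x := by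
  rw [← mul_apply_eq_comp, Ring.inverse_mul_cancel _ hB]; rfl

theorem apply_inverse_apply {B : Y →L[ℂ] Y} (hB : IsUnit B) (x : Y) : B (Ring.inverse B x) = x := by
  rw [← mul_apply_eq_comp, Ring.mul_inverse_cancel _ hB]; rfl

theorem norm_inverse_le_iff {B : Y →L[ℂ] Y} (hB : IsUnit B) {m : ℝ} (hm : 0 < m) :
    ‖Ring.inverse B‖ ≤ m⁻¹ ↔ ∀ x, m * ‖x‖ ≤ ‖B x‖ := by
  constructor
  · intro h x
    have h1 := ContinuousLinearMap.le_of_opNorm_le _ h (B x)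
    rw [inverse_apply_apply hB] at h1
    calc m * ‖x‖ ≤ m * (m⁻¹ * ‖B x‖) := mul_le_mul_of_nonneg_left h1 hm.le
      _ = ‖B x‖ := by field_simp
  · intro h
    refine ContinuousLinearMap.opNorm_le_bound _ (by positivity) fun x => ?_
    have := h (Ring.inverse B x)
    rw [apply_inverse_apply hB] at this
    rw [inv_mul_eq_div, le_div_iff₀ hm]; linarith

theorem ofReal_le_inv_normInv_iff {B : Y →L[ℂ] Y} {m : ℝ} (hm : 0 < m) :
    ENNReal.ofReal m ≤ (normInv B)⁻¹ ↔ IsUnit B ∧ ∀ x, m * ‖x‖ ≤ ‖B x‖ := by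
  by_cases hB : IsUnit B
  · rw [← norm_inverse_le_iff hB hm, normInv, if_pos hB, ENNReal.le_inv_iff_le_inv,
      ← ENNReal.ofReal_inv_of_pos hm, ← ofReal_norm,
      ENNReal.ofReal_le_ofReal_iff (by positivity)]
    simp [hB]
  · simp [normInv, hB, hm]

theorem lt_inv_normInv_iff {B : Y →L[ℂ] Y} {ε : ℝ} (hε : 0 ≤ ε) :
    ENNReal.ofReal ε < (normInv B)⁻¹ ↔
      ∃ m, ε < m ∧ IsUnit B ∧ ∀ x, m * ‖x‖ ≤ ‖B x‖ := by
  constructor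
  · intro h
    obtain ⟨c, h1, h2⟩ := exists_between h
    have hc : c ≠ ⊤ := ne_top_of_lt h2
    rw [ENNReal.ofReal_lt_iff_lt_toReal hε hc] at h1
    refine ⟨c.toReal, h1, ?_⟩
    rw [← ofReal_le_inv_normInv_iff (hε.trans_lt h1), ENNReal.ofReal_toReal hc]
    exact h2.le
  · rintro ⟨m, hm, h⟩
    rw [← ofReal_le_inv_normInv_iff (hε.trans_lt hm)] at h
    exact ((ENNReal.ofReal_lt_ofReal_iff (hε.trans_lt hm)).2 hm).trans_le h

theorem notMem_openPseudospectrum_iff {B : Y →L[ℂ] Y} {ε : ℝ} (hε : 0 < ε) {z : ℂ} :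
    z ∉ openPseudospectrum ε B ↔ IsUnit (B - z • ContinuousLinearMap.id ℂ Y) ∧
      ∀ x, ε * ‖x‖ ≤ ‖(B - z • ContinuousLinearMap.id ℂ Y) x‖ := by
  rw [← ofReal_le_inv_normInv_iff hε, ← not_lt]; rfl

theorem notMem_closedPseudospectrum_iff {B : Y →L[ℂ] Y} {ε : ℝ} (hε : 0 ≤ ε) {z : ℂ} :
    z ∉ closedPseudospectrum ε B ↔ ∃ m, ε < m ∧ IsUnit (B - z • ContinuousLinearMap.id ℂ Y) ∧
      ∀ x, m * ‖x‖ ≤ ‖(B - z • ContinuousLinearMap.id ℂ Y) x‖ := by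
  rw [← lt_inv_normInv_iff hε, ← not_le]; rfl

/-- A bounded below operator is invertible if no nonzero functional vanishes on its range. -/
theorem isUnit_of_bounded_below [CompleteSpace Y] {B : Y →L[ℂ] Y} {m : ℝ} (hm : 0 < m)
    (h : ∀ x, m * ‖x‖ ≤ ‖B x‖) (hd : ∀ f : StrongDual ℂ Y, f.comp B = 0 → f = 0) :
    IsUnit B := by
  rw [ContinuousLinearMap.isUnit_iff_bijective,
    ContinuousLinearMap.bijective_iff_dense_range_and_antilipschitz]
  refine ⟨?_, ⟨m.toNNReal⁻¹, ContinuousLinearMap.antilipschitz_of_bound _ fun x => ?_⟩⟩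
  · by_contra hne
    -- A norming functional of the class of `x` in the quotient by `S`, pulled back, vanishes on the
    -- range but not at `x`.
    set S := B.range.topologicalClosure with hS
    have hclosed : IsClosed (S : Set Y) := Submodule.isClosed_topologicalClosure _
    obtain ⟨x, hx⟩ : ∃ x, x ∉ S := by
      by_contra! hall
      exact hne (Submodule.eq_top_iff'.2 hall)
    have hx0 : ‖S.mkQL x‖ ≠ 0 := by
      rw [norm_ne_zero_iff]
      exact fun h => hx ((Submodule.Quotient.mk_eq_zero S).1 h)
    obtain ⟨g, -, hg⟩ := exists_dual_vector ℂ (S.mkQL x) hx0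
    have hf : (g.comp S.mkQL).comp B = 0 := by
      ext y
      have : S.mkQL (B y) = 0 :=
        (Submodule.Quotient.mk_eq_zero S).2 (Submodule.le_topologicalClosure _ ⟨y, rfl⟩)
      simp only [ContinuousLinearMap.comp_apply, this, map_zero, zero_apply]
    have := congrArg (fun f : StrongDual ℂ Y => f x) (hd _ hf)
    simp only [ContinuousLinearMap.comp_apply, hg, zero_apply] at this
    exact hx0 (Complex.ofReal_eq_zero.1 this)
  · rw [NNReal.coe_inv, Real.coe_toNNReal _ hm.le, inv_mul_eq_div, le_div_iff₀ hm]
    linarith [h x]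

end LowerBounds

/-! ### Functionals on `ℓ²` sums -/

section Functionals

variable {X : Type*} [NormedAddCommGroup X] [NormedSpace ℂ X]

/-- Norms of functionals need not be attained, so a near-maximiser is rotated to make its value real
and scaled by `‖g‖`; the loss is the factor `ρ`. -/
theorem exists_apply_eq_ofReal (g : StrongDual ℂ X) {ρ : ℝ} (hρ : ρ < 1) :
    ∃ (v : X) (c : ℝ), ‖v‖ ≤ ‖g‖ ∧ g v = c ∧ ρ * ‖g‖ ^ 2 ≤ c := by
  rcases (norm_nonneg g).eq_or_lt with h0 | h0
  · exact ⟨0, 0, by simp, by simp, by simp [← h0]⟩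
  obtain ⟨x, hx, hgx⟩ := g.exists_lt_apply_of_lt_opNorm (r := max ρ 0 * ‖g‖)
    (by nlinarith [max_lt hρ one_pos])
  have hpos : 0 < ‖g x‖ := lt_of_le_of_lt (by positivity) hgx
  refine ⟨(‖g‖ * (starRingEnd ℂ (g x) / ‖g x‖) : ℂ) • x, ‖g‖ * ‖g x‖, ?_, ?_, ?_⟩
  · rw [norm_smul, norm_mul, norm_div, RCLike.norm_conj, Complex.norm_real, Complex.norm_real,
      norm_norm, norm_norm, div_self hpos.ne', mul_one]
    exact mul_le_of_le_one_right h0.le hx.le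
  · rw [map_smul, smul_eq_mul, mul_assoc, div_mul_eq_mul_div, mul_comm (starRingEnd ℂ _),
      Complex.mul_conj, Complex.normSq_eq_norm_sq]
    have : (‖g x‖ : ℂ) ≠ 0 := by exact_mod_cast hpos.ne'
    push_cast; field_simp
  · have : ρ ≤ max ρ 0 := le_max_left _ _
    nlinarith

/-- If the maps `u i` embed `X ^ s` with its `ℓ²` norm contractively into `Z`, then the
restrictions of a functional on `Z` are square summable. -/
theorem sum_sq_norm_comp_le {ι Z : Type*} [NormedAddCommGroup Z] [NormedSpace ℂ Z]
    (s : Finset ι) (u : ι → (X →L[ℂ] Z))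
    (hu : ∀ v : ι → X, ‖∑ i ∈ s, u i (v i)‖ ^ 2 ≤ ∑ i ∈ s, ‖v i‖ ^ 2) (f : StrongDual ℂ Z) :
    ∑ i ∈ s, ‖f.comp (u i)‖ ^ 2 ≤ ‖f‖ ^ 2 := by
  set S := ∑ i ∈ s, ‖f.comp (u i)‖ ^ 2 with hS
  have S0 : 0 ≤ S := Finset.sum_nonneg fun i _ => sq_nonneg _
  have key : ∀ ρ : ℝ, ρ < 1 → ρ * S ≤ ‖f‖ * √S := by
    intro ρ hρ
    -- Testing `f` on the combined near-maximisers gives almost `S`, while the test vector has norm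
    -- at most `√S`.
    choose v c hv hc hρc using fun i => exists_apply_eq_ofReal (f.comp (u i)) hρ
    have h1 : f (∑ i ∈ s, u i (v i)) = ((∑ i ∈ s, c i : ℝ) : ℂ) := by
      rw [map_sum, Complex.ofReal_sum]
      exact Finset.sum_congr rfl fun i _ => hc i
    have h2 : ρ * S ≤ ∑ i ∈ s, c i := by
      rw [hS, Finset.mul_sum]
      exact Finset.sum_le_sum fun i _ => hρc i
    have h3 : ‖∑ i ∈ s, u i (v i)‖ ≤ √S := by
      refine Real.le_sqrt_of_sq_le ((hu v).trans (Finset.sum_le_sum fun i _ => ?_))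
      exact pow_le_pow_left₀ (norm_nonneg _) (hv i) 2
    calc ρ * S ≤ ∑ i ∈ s, c i := h2
      _ ≤ ‖f (∑ i ∈ s, u i (v i))‖ := by rw [h1, Complex.norm_real]; exact Real.le_norm_self _
      _ ≤ ‖f‖ * ‖∑ i ∈ s, u i (v i)‖ := f.le_opNorm _
      _ ≤ ‖f‖ * √S := mul_le_mul_of_nonneg_left h3 (norm_nonneg _)
  have h : S ≤ ‖f‖ * √S := by
    have ht : Filter.Tendsto (fun ρ : ℝ => ρ * S) (nhdsWithin 1 (Set.Iio 1)) (nhds (1 * S)) :=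
      ((continuous_id.mul continuous_const).tendsto 1).mono_left nhdsWithin_le_nhds
    rw [one_mul] at ht
    refine le_of_tendsto ht ?_
    filter_upwards [self_mem_nhdsWithin] with ρ hρ using key ρ hρ
  have h4 : √S ≤ ‖f‖ := by
    rcases (Real.sqrt_nonneg S).eq_or_lt with h0 | h0
    · rw [← h0]; exact norm_nonneg _
    · refine le_of_mul_le_mul_right ?_ h0
      rwa [Real.mul_self_sqrt S0]
  calc S = √S ^ 2 := (Real.sq_sqrt S0).symm
    _ ≤ ‖f‖ ^ 2 := pow_le_pow_left₀ (Real.sqrt_nonneg _) h4 2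

/-- The embedding of `X` as the `i`-th summand of `X ^ n`. -/
noncomputable def singleL {n : ℕ} (i : Fin n) : X →L[ℂ] PiLp 2 (fun _ : Fin n => X) :=
  ((PiLp.continuousLinearEquiv 2 ℂ (fun _ : Fin n => X)).symm :
      (Fin n → X) →L[ℂ] PiLp 2 (fun _ : Fin n => X)).comp
    (ContinuousLinearMap.single ℂ (fun _ : Fin n => X) i)

theorem singleL_apply {n : ℕ} (i j : Fin n) (v : X) :
    singleL i v j = Pi.single (M := fun _ : Fin n => X) i v j := rfl

theorem sum_singleL {n : ℕ} (x : PiLp 2 (fun _ : Fin n => X)) : ∑ i, singleL i (x i) = x := by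
  ext j
  simp [singleL_apply, WithLp.ofLp_sum]

/-- The dual of an `ℓ²` sum is normed as the `ℓ²` sum of the duals; the second inequality is
Cauchy-Schwarz. No reflexivity of `X` enters. -/
theorem norm_sq_dual_piLp {n : ℕ} (f : StrongDual ℂ (PiLp 2 (fun _ : Fin n => X))) :
    ∑ i, ‖f.comp (singleL i)‖ ^ 2 = ‖f‖ ^ 2 := by
  refine le_antisymm (sum_sq_norm_comp_le _ _ (fun v => ?_) f) ?_
  · have := sum_singleL (WithLp.toLp 2 v)
    simp only at this
    rw [this, PiLp.norm_sq_eq_of_L2]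
  · set S := ∑ i, ‖f.comp (singleL i)‖ ^ 2
    have S0 : 0 ≤ S := Finset.sum_nonneg fun i _ => sq_nonneg _
    have h : ‖f‖ ≤ √S := by
      refine ContinuousLinearMap.opNorm_le_bound _ (Real.sqrt_nonneg _) fun x => ?_
      have h1 : f x = ∑ i, f.comp (singleL i) (x i) := by
        conv_lhs => rw [← sum_singleL x, map_sum]
        rfl
      have h2 : ‖f x‖ ≤ ∑ i, ‖f.comp (singleL i)‖ * ‖x i‖ := by
        rw [h1]
        exact norm_sum_le_of_le _ fun i _ => ContinuousLinearMap.le_opNorm _ _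
      have h3 := Real.sum_mul_le_sqrt_mul_sqrt Finset.univ
        (fun i => ‖f.comp (singleL i)‖) (fun i => ‖x i‖)
      rw [← PiLp.norm_sq_eq_of_L2, Real.sqrt_sq (norm_nonneg _)] at h3
      exact h2.trans h3
    calc ‖f‖ ^ 2 ≤ √S ^ 2 := pow_le_pow_left₀ (norm_nonneg _) h 2
      _ = S := Real.sq_sqrt S0

end Functionals

/-! ### Tridiagonal operators on `ℓ²(ℤ, X)` -/

section Tridiagonal

variable {X : Type*} [NormedAddCommGroup X] [NormedSpace ℂ X]

theorem hasSum_norm_sq {X : Type*} [NormedAddCommGroup X] (x : E X) :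
    HasSum (fun i => ‖x i‖ ^ 2) (‖x‖ ^ 2) := by
  have := lp.hasSum_norm (p := 2) (by norm_num) x
  simpa using this

theorem sum_norm_sq_single {X : Type*} [NormedAddCommGroup X] (v : ℤ → X) (s : Finset ℤ) :
    ‖∑ i ∈ s, (lp.single 2 i (v i) : E X)‖ ^ 2 = ∑ i ∈ s, ‖v i‖ ^ 2 := by
  have := lp.norm_sum_single (p := 2) (E := fun _ : ℤ => X) (by norm_num) v s
  simpa using this

theorem sum_three {M : Type*} [AddCommMonoid M] (g : ℤ → M) (i : ℤ) :
    ∑ j ∈ {i - 1, i, i + 1}, g j = g (i - 1) + g i + g (i + 1) := by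
  rw [Finset.sum_insert (by simp; omega), Finset.sum_insert (by simp), Finset.sum_singleton,
    add_assoc]

theorem one_lt_abs_sub_of_notMem {i j : ℤ} (h : j ∉ ({i - 1, i, i + 1} : Finset ℤ)) :
    1 < |i - j| := by
  simp only [Finset.mem_insert, Finset.mem_singleton, not_or] at h
  rw [lt_abs]; omega

theorem apply_of_isTridiagonal {A : E X →L[ℂ] E X} (hA : IsTridiagonal A) (x : E X) (i : ℤ) :
    A x i = entry A i (i - 1) (x (i - 1)) + entry A i i (x i) + entry A i (i + 1) (x (i + 1)) := by
  have h1 : HasSum (fun j => entry A i j (x j)) (A x i) :=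
    (lp.hasSum_single (by norm_num) x).mapL ((coord i).comp A)
  have h2 : HasSum (fun j => entry A i j (x j)) (∑ j ∈ {i - 1, i, i + 1}, entry A i j (x j)) :=
    hasSum_sum_of_ne_finset_zero fun j hj => by
      rw [hA i j (one_lt_abs_sub_of_notMem hj), zero_apply]
  rw [h1.unique h2, sum_three]

theorem apply_single_of_isTridiagonal {A : E X →L[ℂ] E X} (hA : IsTridiagonal A) (j : ℤ) (v : X) :
    A (lp.single 2 j v) = ∑ i ∈ {j - 1, j, j + 1}, (lp.single 2 i (entry A i j v) : E X) := by
  refine lp.ext (funext fun i => ?_)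
  rw [lp.coeFn_sum, Finset.sum_apply, ← entry_apply]
  simp only [lp.single_apply, Pi.single_apply]
  rw [Finset.sum_ite_eq]
  split_ifs with h
  · rfl
  · have h' : 1 < |i - j| := by
      rw [abs_sub_comm]; exact one_lt_abs_sub_of_notMem h
    rw [hA i j h', zero_apply]

theorem bddAbove_norm_entry (A : E X →L[ℂ] E X) (f g : ℤ → ℤ) :
    BddAbove (Set.range fun j => ‖entry A (f j) (g j)‖) :=
  ⟨‖A‖, by rintro _ ⟨j, rfl⟩; exact norm_entry_le A _ _⟩

theorem norm_entry_le_supNorm_subdiag (A : E X →L[ℂ] E X) (j : ℤ) :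
    ‖entry A (j + 1) j‖ ≤ supNorm (subdiag A) :=
  le_ciSup (bddAbove_norm_entry A (fun j => j + 1) fun j => j) j

theorem norm_entry_le_supNorm_superdiag (A : E X →L[ℂ] E X) (j : ℤ) :
    ‖entry A (j - 1) j‖ ≤ supNorm (superdiag A) :=
  le_ciSup (bddAbove_norm_entry A (fun j => j - 1) fun j => j) j

theorem supNorm_nonneg (u : ℤ → (X →L[ℂ] X)) : 0 ≤ supNorm u :=
  Real.iSup_nonneg fun _ => norm_nonneg _

theorem norm_sq_principalSubmatrix (n : ℕ) (k : ℤ) (A : E X →L[ℂ] E X) (v : Fin n → X) :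
    ‖principalSubmatrix n k A (WithLp.toLp 2 v)‖ ^ 2 =
      ∑ i : Fin n, ‖∑ j : Fin n, entry A (k + 1 + (i : ℕ)) (k + 1 + (j : ℕ)) (v j)‖ ^ 2 := by
  rw [PiLp.norm_sq_eq_of_L2]
  simp only [principalSubmatrix_apply]

theorem bounded_below_of_sections {A : E X →L[ℂ] E X} (hA : IsTridiagonal A) {n : ℕ} (hn : 1 ≤ n)
    {m : ℝ} (hm : 0 ≤ m)
    (hsec : ∀ k, ∀ x, m * ‖x‖ ≤ ‖principalSubmatrix n k A x‖) (x : E X) :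
    (m - penalty n A) * ‖x‖ ≤ ‖A x‖ := by
  have h := mul_sqrt_le_of_sections hn hA (norm_entry_le_supNorm_subdiag A)
    (norm_entry_le_supNorm_superdiag A) (m := m) (fun k v => ?_)
    (hasSum_norm_sq x) (apply_of_isTridiagonal hA x) (hasSum_norm_sq (A x))
  · rw [Real.sqrt_sq (norm_nonneg _), Real.sqrt_sq (norm_nonneg _)] at h
    unfold penalty
    linarith
  · rw [← norm_sq_principalSubmatrix]
    have h1 := pow_le_pow_left₀ (by positivity) (hsec k (WithLp.toLp 2 v)) 2
    rwa [mul_pow, PiLp.norm_sq_eq_of_L2] at h1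

/-! ### The transposed matrix and density of the range -/

/-- The transposed entry, acting on functionals. -/
noncomputable def entryDual (A : E X →L[ℂ] E X) (i j : ℤ) : StrongDual ℂ X →L[ℂ] StrongDual ℂ X :=
  (ContinuousLinearMap.compL ℂ X X ℂ).flip (entry A j i)

theorem entryDual_apply (A : E X →L[ℂ] E X) (i j : ℤ) (f : StrongDual ℂ X) :
    entryDual A i j f = f.comp (entry A j i) := rfl

theorem norm_entryDual_le (A : E X →L[ℂ] E X) (i j : ℤ) : ‖entryDual A i j‖ ≤ ‖entry A j i‖ := by
  refine ContinuousLinearMap.opNorm_le_bound _ (norm_nonneg _) fun f => ?_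
  rw [entryDual_apply, mul_comm]
  exact ContinuousLinearMap.opNorm_comp_le _ _

/-- The tuple `v` is a functional `f` on `X ^ n`, and the transposed section sends it to `f ∘ P`.
Invertibility of `P` is what carries the bound to the dual side: `f = (f ∘ P) ∘ P⁻¹`. -/
theorem bounded_below_dual_section {A : E X →L[ℂ] E X} {n : ℕ} {k : ℤ} {m : ℝ} (hm : 0 < m)
    (hu : IsUnit (principalSubmatrix n k A))
    (hsec : ∀ x, m * ‖x‖ ≤ ‖principalSubmatrix n k A x‖) (v : Fin n → StrongDual ℂ X) :
    m ^ 2 * ∑ i, ‖v i‖ ^ 2 ≤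
      ∑ i : Fin n, ‖∑ j : Fin n, entryDual A (k + 1 + (i : ℕ)) (k + 1 + (j : ℕ)) (v j)‖ ^ 2 := by
  set P := principalSubmatrix n k A with hP
  set f : StrongDual ℂ (PiLp 2 (fun _ : Fin n => X)) :=
    ∑ j, (v j).comp (PiLp.proj 2 (fun _ : Fin n => X) j) with hf
  have h1 : ∀ i, f.comp (singleL i) = v i := by
    intro i
    ext w
    simp only [hf, ContinuousLinearMap.comp_apply, sum_apply, PiLp.proj_apply,
      singleL_apply]
    rw [Finset.sum_eq_single i]
    · simp
    · intro j _ hj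
      rw [Pi.single_eq_of_ne hj, map_zero]
    · simp
  have h2 : ∀ i, (f.comp P).comp (singleL i) =
      ∑ j : Fin n, entryDual A (k + 1 + (i : ℕ)) (k + 1 + (j : ℕ)) (v j) := by
    intro i
    ext w
    simp only [hf, ContinuousLinearMap.comp_apply, sum_apply, PiLp.proj_apply,
      entryDual_apply, hP, principalSubmatrix_apply, singleL_apply]
    refine Finset.sum_congr rfl fun j _ => ?_
    rw [Finset.sum_eq_single i]
    · simp
    · intro l _ hl
      rw [Pi.single_eq_of_ne hl, map_zero]
    · simp
  have e1 := norm_sq_dual_piLp f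
  have e2 := norm_sq_dual_piLp (f.comp P)
  simp only [h1] at e1
  simp only [h2] at e2
  rw [e1, e2]
  have h3 : ‖f‖ ≤ ‖f.comp P‖ * m⁻¹ := by
    have : f = (f.comp P).comp (Ring.inverse P) := by
      ext x
      simp only [ContinuousLinearMap.comp_apply, apply_inverse_apply hu]
    calc ‖f‖ = ‖(f.comp P).comp (Ring.inverse P)‖ := by rw [← this]
      _ ≤ ‖f.comp P‖ * ‖Ring.inverse P‖ := ContinuousLinearMap.opNorm_comp_le _ _
      _ ≤ _ := mul_le_mul_of_nonneg_left ((norm_inverse_le_iff hu hm).2 hsec) (norm_nonneg _)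
  rw [← mul_pow]
  refine pow_le_pow_left₀ (by positivity) ?_ 2
  rw [← div_eq_mul_inv, le_div_iff₀ hm] at h3
  linarith

/-- The coordinates of `f` are square summable and are mapped to zero by the transposed tridiagonal
matrix. The sequence version of the lower bound applies to them, without any operator on `ℓ²(ℤ, X*)`
having to be built. -/
theorem eq_zero_of_comp_eq_zero {A : E X →L[ℂ] E X} (hA : IsTridiagonal A) {n : ℕ} (hn : 1 ≤ n)
    {m : ℝ} (hm : penalty n A < m)
    (hsec : ∀ k, IsUnit (principalSubmatrix n k A) ∧ ∀ x, m * ‖x‖ ≤ ‖principalSubmatrix n k A x‖)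
    {f : StrongDual ℂ (E X)} (hf : f.comp A = 0) : f = 0 := by
  have hm0 : 0 < m := (penaltyOf_nonneg hn _ _).trans_lt hm
  set g : ℤ → StrongDual ℂ X :=
    fun i => f.comp (lp.singleContinuousLinearMap ℂ (fun _ : ℤ => X) 2 i) with hg
  have hsum : Summable fun i => ‖g i‖ ^ 2 :=
    summable_of_sum_le (fun _ => sq_nonneg _) fun s =>
      sum_sq_norm_comp_le s _ (fun v => (sum_norm_sq_single v s).le) f
  have hzero : ∀ i, (fun _ => (0 : StrongDual ℂ X)) i = entryDual A i (i - 1) (g (i - 1))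
      + entryDual A i i (g i) + entryDual A i (i + 1) (g (i + 1)) := by
    intro i
    ext v
    have h := congrArg (fun F : StrongDual ℂ (E X) => F (lp.single 2 i v)) hf
    simp only [ContinuousLinearMap.comp_apply, apply_single_of_isTridiagonal hA, map_sum,
      zero_apply] at h
    rw [sum_three] at h
    exact h.symm
  -- Transposition exchanges the diagonals, hence the swapped roles of `r` and `s`.
  have h := mul_sqrt_le_of_sections hn (b := entryDual A) (r := supNorm (superdiag A))
    (s := supNorm (subdiag A)) (m := m)
    (fun i j hij => by
      have : entry A j i = 0 := hA j i (by rwa [abs_sub_comm])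
      ext v
      simp [entryDual_apply, this])
    (fun j => (norm_entryDual_le A _ _).trans (by
      simpa using norm_entry_le_supNorm_superdiag A (j + 1)))
    (fun j => (norm_entryDual_le A _ _).trans (by
      simpa using norm_entry_le_supNorm_subdiag A (j - 1)))
    (fun k v => bounded_below_dual_section hm0 (hsec k).1 (hsec k).2 v)
    hsum.hasSum hzero (Z := 0) (by simp)
  rw [penaltyOf_comm, Real.sqrt_zero, zero_add] at h
  change m * _ ≤ penalty n A * _ at h
  have hs0 : ∑' i, ‖g i‖ ^ 2 = 0 := by
    by_contra hne
    have hpos : 0 < √(∑' i, ‖g i‖ ^ 2) :=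
      Real.sqrt_pos.2 (lt_of_le_of_ne (tsum_nonneg fun _ => sq_nonneg _) (Ne.symm hne))
    nlinarith
  refine lp.ext_continuousLinearMap (by norm_num) fun i => ?_
  have := (hasSum_zero_iff_of_nonneg fun _ => sq_nonneg _).1 (hs0 ▸ hsum.hasSum)
  have hi : g i = 0 := by simpa using congrFun this i
  rw [ContinuousLinearMap.zero_comp]
  exact hi

theorem isUnit_of_sections [CompleteSpace X] {A : E X →L[ℂ] E X} (hA : IsTridiagonal A) {n : ℕ}
    (hn : 1 ≤ n) {m : ℝ} (hm : penalty n A < m)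
    (hsec : ∀ k, IsUnit (principalSubmatrix n k A) ∧ ∀ x, m * ‖x‖ ≤ ‖principalSubmatrix n k A x‖) :
    IsUnit A :=
  isUnit_of_bounded_below (sub_pos.2 hm)
    (bounded_below_of_sections hA hn ((penaltyOf_nonneg hn _ _).trans hm.le) fun k => (hsec k).2)
    fun _ => eq_zero_of_comp_eq_zero hA hn hm hsec

/-! ### Shifting by a multiple of the identity -/

theorem entry_sub_smul_of_ne (A : E X →L[ℂ] E X) (z : ℂ) {i j : ℤ} (h : i ≠ j) :
    entry (A - z • ContinuousLinearMap.id ℂ (E X)) i j = entry A i j := by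
  ext v
  have e : entry (A - z • ContinuousLinearMap.id ℂ (E X)) i j v
      = entry A i j v - z • coord i (lp.single 2 j v) := rfl
  have e' : coord i (lp.single 2 j v : E X) = 0 := lp.single_apply_ne (E := fun _ : ℤ => X) 2 j v h
  rw [e, e', smul_zero, sub_zero]

theorem entry_sub_smul_self (A : E X →L[ℂ] E X) (z : ℂ) (i : ℤ) :
    entry (A - z • ContinuousLinearMap.id ℂ (E X)) i i
      = entry A i i - z • ContinuousLinearMap.id ℂ X := by
  ext v
  have e : entry (A - z • ContinuousLinearMap.id ℂ (E X)) i i v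
      = entry A i i v - z • coord i (lp.single 2 i v) := rfl
  have e' : coord i (lp.single 2 i v : E X) = v := lp.single_apply_self (E := fun _ : ℤ => X) 2 i v
  rw [e, e']
  rfl

theorem IsTridiagonal.sub_smul {A : E X →L[ℂ] E X} (hA : IsTridiagonal A) (z : ℂ) :
    IsTridiagonal (A - z • ContinuousLinearMap.id ℂ (E X)) := fun i j hij => by
  rw [entry_sub_smul_of_ne, hA i j hij]
  rintro rfl
  simp at hij

theorem penalty_sub_smul (n : ℕ) (A : E X →L[ℂ] E X) (z : ℂ) :
    penalty n (A - z • ContinuousLinearMap.id ℂ (E X)) = penalty n A := by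
  have h1 : subdiag (A - z • ContinuousLinearMap.id ℂ (E X)) = subdiag A :=
    funext fun j => entry_sub_smul_of_ne A z (by simp)
  have h2 : superdiag (A - z • ContinuousLinearMap.id ℂ (E X)) = superdiag A :=
    funext fun j => entry_sub_smul_of_ne A z (by simp)
  rw [penalty, penalty, h1, h2]

theorem principalSubmatrix_sub_smul (n : ℕ) (k : ℤ) (A : E X →L[ℂ] E X) (z : ℂ) :
    principalSubmatrix n k (A - z • ContinuousLinearMap.id ℂ (E X)) =
      principalSubmatrix n k A - z • ContinuousLinearMap.id ℂ (PiLp 2 (fun _ : Fin n => X)) := by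
  ext x i
  have h : ∀ j : Fin n, entry (A - z • ContinuousLinearMap.id ℂ (E X)) (k + 1 + (i : ℕ))
      (k + 1 + (j : ℕ)) (x j) = entry A (k + 1 + (i : ℕ)) (k + 1 + (j : ℕ)) (x j)
        - if i = j then z • x j else 0 := by
    intro j
    split_ifs with hij
    · subst hij
      rw [entry_sub_smul_self]; rfl
    · rw [entry_sub_smul_of_ne _ _ (by rw [Ne, add_right_inj, Nat.cast_inj, ← Fin.ext_iff]
                                       exact hij), sub_zero]
  simp only [principalSubmatrix_apply, h, Finset.sum_sub_distrib, Finset.sum_ite_eq,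
    Finset.mem_univ, if_true, sub_apply, PiLp.sub_apply,
    smul_apply, PiLp.smul_apply, ContinuousLinearMap.id_apply]

/-- Contrapositive: outside the union every section of `A - z` is invertible with lower bound `ε +
ε_n`. Subtracting `z` changes only the diagonal, so the penalty is unaffected. -/
theorem openPseudospectrum_subset [CompleteSpace X] {A : E X →L[ℂ] E X} (hA : IsTridiagonal A)
    {n : ℕ} (hn : 1 ≤ n) {ε : ℝ} (hε : 0 < ε) :
    openPseudospectrum ε A ⊆ openTauSet n (ε + penalty n A) A := by
  intro z hz
  by_contra hnot
  simp only [openTauSet, Set.mem_iUnion, not_exists] at hnot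
  have hp : 0 ≤ penalty n A := penaltyOf_nonneg hn _ _
  simp only [notMem_openPseudospectrum_iff (add_pos_of_pos_of_nonneg hε hp),
    ← principalSubmatrix_sub_smul] at hnot
  refine absurd hz ((notMem_openPseudospectrum_iff hε).2 ⟨isUnit_of_sections (hA.sub_smul z) hn
    (m := ε + penalty n A) (by rw [penalty_sub_smul]; linarith) hnot, fun x => ?_⟩)
  have := bounded_below_of_sections (hA.sub_smul z) hn (by positivity) (fun k => (hnot k).2) x
  rwa [penalty_sub_smul, add_sub_cancel_right] at this

end Tridiagonal

end TauMethod

namespace TauMethod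

/-! ### Bidiagonal operators and the shift -/

theorem supNorm_zero {X : Type*} [NormedAddCommGroup X] [NormedSpace ℂ X] :
    supNorm (0 : ℤ → (X →L[ℂ] X)) = 0 := by
  simp [supNorm]

theorem penalty_of_bidiagonal {X : Type*} [NormedAddCommGroup X] [NormedSpace ℂ X] {n : ℕ}
    (hn : 1 ≤ n) {A : E X →L[ℂ] E X} (h : subdiag A = 0 ∨ superdiag A = 0) :
    penalty n A = 2 * (supNorm (subdiag A) + supNorm (superdiag A)) *
      Real.sin (Real.pi / (4 * n + 2)) := by
  rcases h with h | h
  · rw [penalty, h, supNorm_zero, penaltyOf_comm, penaltyOf_zero_right hn (supNorm_nonneg _),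
      zero_add]
  · rw [penalty, h, supNorm_zero, penaltyOf_zero_right hn (supNorm_nonneg _), add_zero]

/-- A discrete Poincaré inequality, proved by comparison with a positive solution of the
corresponding three-term recurrence, whose quotients are `ρ`. -/
theorem energy_lower_bound {c : ℝ} {ρ u : ℕ → ℝ} (h0 : ρ 0 = 2 * c) (u0 : u 0 = 0) (m : ℕ)
    (hρ : ∀ i ≤ m, 0 < ρ i) (hrec : ∀ i < m, ρ (i + 1) = 2 * c - (ρ i)⁻¹) :
    (2 - 2 * c) * ∑ i ∈ Finset.range (m + 1), u (i + 1) ^ 2 + (ρ m - 1) * u (m + 1) ^ 2 ≤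
      ∑ i ∈ Finset.range (m + 1), (u i - u (i + 1)) ^ 2 := by
  induction m with
  | zero => simp [h0, u0]; linarith
  | succ m ih =>
    have h := ih (fun i hi => hρ i (by omega)) fun i hi => hrec i (by omega)
    rw [Finset.sum_range_succ, Finset.sum_range_succ (n := m + 1)
      (f := fun i => (u i - u (i + 1)) ^ 2), hrec m (by omega)]
    have hp := hρ m (by omega)
    -- The recurrence for `ρ` makes the gain from `m` to `m + 1` a perfect square.
    have e : ρ m * u (m + 1) ^ 2 - 2 * u (m + 1) * u (m + 2) + (ρ m)⁻¹ * u (m + 2) ^ 2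
        = (ρ m)⁻¹ * (ρ m * u (m + 1) - u (m + 2)) ^ 2 := by
      field_simp; ring
    have h2 : 0 ≤ (ρ m)⁻¹ * (ρ m * u (m + 1) - u (m + 2)) ^ 2 := by positivity
    simp only [show m + 1 + 1 = m + 2 from rfl] at *
    linarith

/-- The ground state is `sin (iθ)` with `θ = π / (2n + 1)`: zero at `0`, and equal at `n` and `n +
1`. The last quotient `ρ` is therefore `1`, which removes the boundary term of `energy_lower_bound`.
-/
theorem sum_sq_le_energy {n : ℕ} {u : ℕ → ℝ} (u0 : u 0 = 0) :
    (2 * Real.sin (Real.pi / (4 * n + 2))) ^ 2 * ∑ i ∈ Finset.range n, u (i + 1) ^ 2 ≤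
      ∑ i ∈ Finset.range n, (u i - u (i + 1)) ^ 2 := by
  rcases n with _ | m
  · simp
  set θ := Real.pi / (2 * (m + 1 : ℕ) + 1) with hθ
  have hθ0 : 0 < θ := by positivity
  have hθ' : (2 * ((m : ℝ) + 1) + 1) * θ = Real.pi := by
    rw [hθ]; push_cast; field_simp
  have hm0 : (0 : ℝ) ≤ m := Nat.cast_nonneg m
  have hs : ∀ i : ℕ, i ≤ m + 1 → 0 < Real.sin ((i + 1) * θ) := fun i hi => by
    have hi' : (i : ℝ) ≤ m + 1 := by exact_mod_cast hi
    refine Real.sin_pos_of_pos_of_lt_pi (by positivity) ?_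
    nlinarith
  set ρ : ℕ → ℝ := fun i => Real.sin ((i + 2) * θ) / Real.sin ((i + 1) * θ) with hρ
  have hsin : ∀ x : ℝ, Real.sin (x + 2 * θ) = 2 * Real.cos θ * Real.sin (x + θ) - Real.sin x := by
    intro x
    rw [Real.sin_add, Real.sin_add, Real.sin_two_mul, Real.cos_two_mul]; ring
  have h := energy_lower_bound (c := Real.cos θ) (ρ := ρ) (u := u) ?_ u0 m ?_ ?_
  · have hlast : ρ m = 1 := by
      have : Real.sin ((m + 2) * θ) = Real.sin ((m + 1) * θ) := by
        rw [← Real.sin_pi_sub]; congr 1; linarith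
      simp only [hρ]
      rw [this, div_self (hs m (by omega)).ne']
    have hcos : (2 * Real.sin (Real.pi / (4 * (m + 1 : ℕ) + 2))) ^ 2 = 2 - 2 * Real.cos θ := by
      have e : Real.pi / (4 * (m + 1 : ℕ) + 2) = θ / 2 := by
        rw [hθ]; push_cast; field_simp; ring
      have h1 := Real.cos_two_mul (θ / 2)
      rw [mul_div_cancel₀ _ (two_ne_zero)] at h1
      have h2 := Real.sin_sq_add_cos_sq (θ / 2)
      rw [e]
      nlinarith
    rw [hcos]
    rw [hlast] at h
    linarith
  · have h1 := hs 0 (by omega)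
    simp only [hρ]
    rw [div_eq_iff (by exact h1.ne')]
    have := hsin 0
    rw [zero_add, zero_add, Real.sin_zero, sub_zero] at this
    simpa using this
  · intro i hi
    have h1 := hs i (by omega)
    have h2 := hs (i + 1) (by omega)
    push_cast at h2
    rw [add_assoc, one_add_one_eq_two] at h2
    exact div_pos h2 h1
  · intro i hi
    have h1 := hs i (by omega)
    have h2 := hs (i + 1) (by omega)
    push_cast at h2
    rw [add_assoc, one_add_one_eq_two] at h2
    have := hsin ((i + 1) * θ)
    rw [show ((i : ℝ) + 1) * θ + 2 * θ = (i + 3) * θ by ring,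
      show ((i : ℝ) + 1) * θ + θ = (i + 2) * θ by ring] at this
    simp only [hρ]
    push_cast
    rw [show (i : ℝ) + 1 + 2 = i + 3 by ring, show (i : ℝ) + 1 + 1 = i + 2 by ring, this, inv_div]
    field_simp

/-! ### The shift and sharpness at the point `1` -/

theorem memℓp_shift (x : E ℂ) : Memℓp (fun j : ℤ => (x (j - 1) : ℂ)) 2 :=
  memℓp_gen ((Equiv.subRight (1 : ℤ)).summable_iff.2 ((lp.memℓp x).summable (by norm_num)))

/-- The sequence `j ↦ x (j - 1)`. -/
def shiftSeq (x : E ℂ) : E ℂ := ⟨fun j => x (j - 1), memℓp_shift x⟩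

theorem norm_shiftSeq (x : E ℂ) : ‖shiftSeq x‖ = ‖x‖ := by
  refine (pow_left_inj₀ (norm_nonneg _) (norm_nonneg _) two_ne_zero).1 ?_
  have h := (Equiv.subRight (1 : ℤ)).hasSum_iff.2 (hasSum_norm_sq x)
  exact (hasSum_norm_sq (shiftSeq x)).unique h

/-- The shift `(V x) (j + 1) = x j` on `ℓ²(ℤ, ℂ)`. -/
noncomputable def shift : E ℂ →L[ℂ] E ℂ :=
  LinearMap.mkContinuous
    { toFun := shiftSeq
      map_add' := fun _ _ => rfl
      map_smul' := fun _ _ => rfl }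
    1 (fun x => by rw [one_mul]; exact (norm_shiftSeq x).le)

theorem shift_apply (x : E ℂ) (j : ℤ) : shift x j = x (j - 1) := rfl

theorem entry_shift_apply (i j : ℤ) (v : ℂ) :
    entry shift i j v = if i - 1 = j then v else 0 := by
  rw [entry_apply, shift_apply]
  have := lp.single_apply (E := fun _ : ℤ => ℂ) 2 j v (i - 1)
  rw [this, Pi.single_apply]

theorem entry_shift_of_ne {i j : ℤ} (h : i - 1 ≠ j) : entry shift i j = 0 := by
  ext
  simp [entry_shift_apply, h]

theorem isTridiagonal_shift : IsTridiagonal shift := fun i j hij => entry_shift_of_ne (by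
  rintro rfl
  simp at hij)

theorem superdiag_shift : superdiag shift = 0 :=
  funext fun j => entry_shift_of_ne (by omega)

theorem subdiag_shift (j : ℤ) : subdiag shift j = ContinuousLinearMap.id ℂ ℂ := by
  ext
  simp [subdiag, entry_shift_apply]

theorem penalty_shift {n : ℕ} (hn : 1 ≤ n) :
    penalty n shift = 2 * Real.sin (Real.pi / (4 * n + 2)) := by
  rw [penalty_of_bidiagonal hn (Or.inr superdiag_shift), superdiag_shift, supNorm_zero]
  simp [supNorm, subdiag_shift]

/-- The unit vector at `0` has no preimage: such an `x` would be constant on each of the two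
half-lines, hence zero by summability, contradicting the equation at `0`. -/
theorem not_isUnit_shift_sub_one : ¬ IsUnit (shift - (1 : ℂ) • ContinuousLinearMap.id ℂ (E ℂ)) := by
  intro hu
  obtain ⟨x, hx⟩ := (ContinuousLinearMap.isUnit_iff_bijective.1 hu).2 (lp.single 2 0 1)
  have hj : ∀ j : ℤ, x (j - 1) - x j = if j = 0 then 1 else 0 := by
    intro j
    have h1 : coord j ((shift - (1 : ℂ) • ContinuousLinearMap.id ℂ (E ℂ)) x)
        = x (j - 1) - (1 : ℂ) • x j := rfl
    have h2 : coord j (lp.single 2 0 1 : E ℂ) = if j = 0 then 1 else 0 := by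
      have := lp.single_apply (E := fun _ : ℤ => ℂ) 2 0 1 j
      rw [Pi.single_apply] at this
      exact this
    rw [hx, h2, one_smul] at h1
    exact h1.symm
  have hpos : ∀ k : ℕ, x (k : ℤ) = x 0 := by
    intro k
    induction k with
    | zero => rfl
    | succ k ih =>
      have := hj ((k : ℤ) + 1)
      rw [if_neg (by omega), add_sub_cancel_right, ih, sub_eq_zero] at this
      exact_mod_cast this.symm
  have hneg : ∀ k : ℕ, x (-1 - (k : ℤ)) = x (-1) := by
    intro k
    induction k with
    | zero => simp
    | succ k ih =>
      have := hj (-1 - (k : ℤ))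
      rw [if_neg (by omega), ih, sub_eq_zero, sub_sub] at this
      exact_mod_cast this
  have hsum := (hasSum_norm_sq x).summable
  have h0 : x 0 = 0 := by
    have := hsum.comp_injective (i := fun k : ℕ => (k : ℤ)) Nat.cast_injective
    simp only [Function.comp_def, hpos] at this
    simpa [summable_const_iff] using this
  have h1 : x (-1) = 0 := by
    have := hsum.comp_injective (i := fun k : ℕ => -1 - (k : ℤ)) fun a b h => by simpa using h
    simp only [Function.comp_def, hneg] at this
    simpa [summable_const_iff] using this
  have := hj 0
  rw [zero_sub, h0, h1] at this
  simp at this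

theorem isUnit_of_bounded_below_of_finiteDimensional {Y : Type*} [NormedAddCommGroup Y]
    [NormedSpace ℂ Y] [FiniteDimensional ℂ Y] {B : Y →L[ℂ] Y} {m : ℝ} (hm : 0 < m)
    (h : ∀ x, m * ‖x‖ ≤ ‖B x‖) : IsUnit B := by
  have := FiniteDimensional.complete ℂ Y
  rw [ContinuousLinearMap.isUnit_iff_bijective]
  have hinj : Function.Injective B := (injective_iff_map_eq_zero B).2 fun x hx => by
    have := h x
    rw [hx, norm_zero] at this
    exact norm_eq_zero.1 (le_antisymm (by nlinarith) (norm_nonneg x))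
  exact ⟨hinj, LinearMap.surjective_of_injective (f := (B : Y →ₗ[ℂ] Y)) hinj⟩

theorem principalSubmatrix_shift_apply (n : ℕ) (k : ℤ) (x : PiLp 2 fun _ : Fin n => ℂ)
    (v : ℕ → ℂ) (v0 : v 0 = 0) (hv : ∀ i : Fin n, v (i + 1) = x i) (i : Fin n) :
    principalSubmatrix n k shift x i = v i := by
  rw [principalSubmatrix_apply]
  simp only [entry_shift_apply]
  obtain ⟨i, hi⟩ := i
  rcases i with _ | i
  · simp only [v0]
    refine Finset.sum_eq_zero fun j _ => if_neg (by push_cast; omega)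
  · rw [Finset.sum_eq_single (⟨i, by omega⟩ : Fin n)]
    · rw [if_pos (by push_cast; ring), ← hv]
    · intro j _ hj
      rw [if_neg]
      intro h
      exact hj (Fin.ext (by push_cast at h; simp; omega))
    · simp

/-- At `z = 1` the reverse triangle inequality reduces to the real sequence of moduli and
`sum_sq_le_energy`; moving `z` costs at most `‖z - 1‖`. -/
theorem shift_section_bounded_below (n : ℕ) (k : ℤ) (z : ℂ) (x : PiLp 2 fun _ : Fin n => ℂ) :
    (2 * Real.sin (Real.pi / (4 * n + 2)) - ‖z - 1‖) * ‖x‖ ≤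
      ‖(principalSubmatrix n k shift -
        z • ContinuousLinearMap.id ℂ (PiLp 2 fun _ : Fin n => ℂ)) x‖ := by
  set P := principalSubmatrix n k shift
  have h1 : 2 * Real.sin (Real.pi / (4 * n + 2)) * ‖x‖ ≤ ‖P x - x‖ := by
    set v : ℕ → ℂ := fun j => if h : 1 ≤ j ∧ j ≤ n then x ⟨j - 1, by omega⟩ else 0 with hv
    have v0 : v 0 = 0 := by simp [hv]
    have hvi : ∀ i : Fin n, v (i + 1) = x i := fun i => by
      simp only [hv]
      rw [dif_pos (by omega)]
      rfl
    have h := sum_sq_le_energy (n := n) (u := fun i => ‖v i‖) (by simp [v0])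
    refine abs_le_of_sq_le_sq' ?_ (norm_nonneg _) |>.2
    rw [mul_pow, PiLp.norm_sq_eq_of_L2, PiLp.norm_sq_eq_of_L2]
    have e1 : ∑ i : Fin n, ‖x i‖ ^ 2 = ∑ i ∈ Finset.range n, ‖v (i + 1)‖ ^ 2 := by
      rw [Finset.sum_range]
      exact Finset.sum_congr rfl fun i _ => by rw [hvi]
    have e2 : ∑ i ∈ Finset.range n, (‖v i‖ - ‖v (i + 1)‖) ^ 2 ≤ ∑ i, ‖(P x - x) i‖ ^ 2 := by
      rw [Finset.sum_range]
      refine Finset.sum_le_sum fun i _ => ?_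
      rw [PiLp.sub_apply, principalSubmatrix_shift_apply n k x v v0 hvi, ← hvi, ← sq_abs]
      exact pow_le_pow_left₀ (abs_nonneg _) (abs_norm_sub_norm_le _ _) 2
    rw [e1]
    exact h.trans e2
  have h2 : P x - x = (P - z • ContinuousLinearMap.id ℂ (PiLp 2 fun _ : Fin n => ℂ)) x + (z - 1) • x := by
    rw [sub_apply, smul_apply, ContinuousLinearMap.id_apply, sub_smul, one_smul]
    abel
  have h3 := norm_add_le ((P - z • ContinuousLinearMap.id ℂ (PiLp 2 fun _ : Fin n => ℂ)) x) ((z - 1) • x)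
  rw [← h2, norm_smul] at h3
  linarith

theorem shift_sharp {n : ℕ} (hn : 1 ≤ n) {δ : ℝ} (hδ : 0 ≤ δ) (hlt : δ < penalty n shift) :
    (¬ ∀ ε : ℝ, 0 < ε → openPseudospectrum ε shift ⊆ openTauSet n (ε + δ) shift) ∧
    (¬ ∀ ε : ℝ, 0 ≤ ε → closedPseudospectrum ε shift ⊆ closedTauSet n (ε + δ) shift) := by
  have hb := fun k z => shift_section_bounded_below n k z
  rw [← penalty_shift hn] at hb
  constructor
  · intro h
    -- Any positive `ε` with `ε + δ ≤ ε_n` serves, since `1` lies in every pseudospectrum of the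
    -- shift.
    have hε : 0 < (penalty n shift - δ) / 2 := by linarith
    have hmem : (1 : ℂ) ∈ openPseudospectrum ((penalty n shift - δ) / 2) shift := by
      by_contra hnot
      exact not_isUnit_shift_sub_one ((notMem_openPseudospectrum_iff hε).1 hnot).1
    obtain ⟨k, hk⟩ := Set.mem_iUnion.1 (h _ hε hmem)
    have hb1 := hb k 1
    rw [sub_self, norm_zero, sub_zero] at hb1
    refine (notMem_openPseudospectrum_iff (by linarith)).2
      ⟨isUnit_of_bounded_below_of_finiteDimensional (hδ.trans_lt hlt) hb1, fun x => ?_⟩ hk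
    refine le_trans (mul_le_mul_of_nonneg_right ?_ (norm_nonneg x)) (hb1 x)
    linarith
  · intro h
    have hmem : (1 : ℂ) ∈ closedPseudospectrum 0 shift := by
      by_contra hnot
      obtain ⟨m, -, hu, -⟩ := (notMem_closedPseudospectrum_iff le_rfl).1 hnot
      exact not_isUnit_shift_sub_one hu
    have hcl := h 0 le_rfl hmem
    rw [zero_add, closedTauSet, Metric.mem_closure_iff] at hcl
    -- Within this radius of `1` the section bound still exceeds `δ`, so not even the closure
    -- reaches `1`.
    obtain ⟨z, hz, hdist⟩ := hcl (penalty n shift - δ) (by linarith)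
    obtain ⟨k, hk⟩ := Set.mem_iUnion.1 hz
    rw [dist_comm, dist_eq_norm] at hdist
    exact (notMem_closedPseudospectrum_iff hδ).2 ⟨penalty n shift - ‖z - 1‖, by linarith,
      isUnit_of_bounded_below_of_finiteDimensional (by linarith) (hb k z), hb k z⟩ hk

end TauMethod

namespace TauMethod

/-! ### The resolvent near the boundary of its domain -/

section Schwarz

open Metric Complex

/-- The **Schwarz-Pick lemma** at the centre of a disc. -/
theorem norm_deriv_mul_le_of_norm_lt_one {F : ℂ → ℂ} {μ : ℝ} (hμ : 0 < μ)
    (hd : DifferentiableOn ℂ F (ball 0 μ)) (hF : ∀ ζ ∈ ball (0 : ℂ) μ, ‖F ζ‖ < 1) :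
    μ * ‖deriv F 0‖ ≤ 1 - ‖F 0‖ ^ 2 := by
  set a := F 0 with ha
  have h0 : (0 : ℂ) ∈ ball (0 : ℂ) μ := mem_ball_self hμ
  have ha1 : ‖a‖ < 1 := hF 0 h0
  have hsq : 0 < 1 - ‖a‖ ^ 2 := by nlinarith [norm_nonneg a]
  have hden : ∀ w : ℂ, ‖w‖ < 1 → 1 - starRingEnd ℂ a * w ≠ 0 := by
    intro w hw h
    have h1 : ‖starRingEnd ℂ a * w‖ = 1 := by rw [← sub_eq_zero.1 h, norm_one]
    rw [norm_mul, RCLike.norm_conj] at h1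
    nlinarith [norm_nonneg a, norm_nonneg w]
  -- Composition with the disc automorphism sending `a` to `0` reduces the claim to the Schwarz
  -- lemma.
  set G : ℂ → ℂ := fun ζ => (F ζ - a) / (1 - starRingEnd ℂ a * F ζ) with hG
  have hG0 : G 0 = 0 := by simp [hG, ← ha]
  have hGd : DifferentiableOn ℂ G (ball 0 μ) :=
    (hd.sub_const a).div ((differentiableOn_const 1).sub (hd.const_mul _))
      fun ζ hζ => hden _ (hF ζ hζ)
  have hGm : Set.MapsTo G (ball 0 μ) (closedBall (G 0) 1) := by
    intro ζ hζ
    rw [hG0, mem_closedBall, dist_zero_right, norm_div,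
      div_le_one (norm_pos_iff.2 (hden _ (hF ζ hζ)))]
    have hw := hF ζ hζ
    refine (pow_le_pow_iff_left₀ (norm_nonneg _) (norm_nonneg _) two_ne_zero).1 ?_
    have e : ‖1 - starRingEnd ℂ a * F ζ‖ ^ 2 - ‖F ζ - a‖ ^ 2
        = (1 - ‖a‖ ^ 2) * (1 - ‖F ζ‖ ^ 2) := by
      simp only [← normSq_eq_norm_sq, normSq_apply, sub_re, sub_im, mul_re, mul_im, conj_re,
        conj_im, one_re, one_im]
      ring
    have : 0 ≤ (1 - ‖a‖ ^ 2) * (1 - ‖F ζ‖ ^ 2) :=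
      mul_nonneg hsq.le (by nlinarith [norm_nonneg (F ζ)])
    linarith
  have hle := norm_deriv_le_div_of_mapsTo_ball hGd hGm hμ
  have hF' : HasDerivAt F (deriv F 0) 0 := (hd.differentiableAt (ball_mem_nhds 0 hμ)).hasDerivAt
  have hG' : HasDerivAt G (deriv F 0 / (1 - ‖a‖ ^ 2 : ℝ)) 0 := by
    have h1 := (hF'.sub_const a).fun_div ((hF'.const_mul (starRingEnd ℂ a)).const_sub 1)
      (hden _ ha1)
    have e : starRingEnd ℂ a * a = (‖a‖ ^ 2 : ℝ) := by
      rw [mul_comm, mul_conj, normSq_eq_norm_sq]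
    refine h1.congr_deriv ?_
    rw [← ha, e, sub_self, zero_mul, sub_zero]
    have : (1 : ℂ) - (‖a‖ ^ 2 : ℝ) ≠ 0 := by
      exact_mod_cast hsq.ne'
    push_cast at this ⊢
    field_simp
  rw [hG'.deriv, norm_div, norm_real, Real.norm_of_nonneg hsq.le,
    div_le_div_iff₀ hsq hμ] at hle
  linarith

/-- An analytic function into the unit ball of a normed space: the value and half of the first
Taylor coefficient span a complex disc in the unit ball. -/
theorem norm_add_smul_deriv_le_one {Z : Type*} [NormedAddCommGroup Z] [NormedSpace ℂ Z]
    {g : ℂ → Z} {g' : Z} {μ : ℝ} (hμ : 0 < μ) (hd : DifferentiableOn ℂ g (ball 0 μ))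
    (hg' : HasDerivAt g g' 0)
    (hg : ∀ ζ ∈ ball (0 : ℂ) μ, ‖g ζ‖ ≤ 1) {ζ : ℂ} (hζ : ‖ζ‖ ≤ 1) :
    ‖g 0 + ζ • ((μ / 2 : ℝ) : ℂ) • g'‖ ≤ 1 := by
  set y := g 0 + ζ • ((μ / 2 : ℝ) : ℂ) • g' with hy
  obtain ⟨f, hf, hfy⟩ := exists_dual_vector'' ℂ y
  -- The factor `ρ` makes the bound strict, as Schwarz-Pick requires. The claim is then `‖F 0‖ + (1
  -- - ‖F 0‖²) / 2 ≤ 1`, which explains the half in `μ / 2`.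
  have key : ∀ ρ ∈ Set.Ico (0 : ℝ) 1, ρ * ‖y‖ ≤ 1 := by
    intro ρ hρ
    set F : ℂ → ℂ := fun ζ => ρ * f (g ζ) with hF
    have hFd : DifferentiableOn ℂ F (ball 0 μ) :=
      (f.differentiable.comp_differentiableOn hd).const_mul _
    have hfz : ∀ z, ‖f z‖ ≤ ‖z‖ := fun z => by
      simpa using f.le_of_opNorm_le hf z
    have hFn : ∀ ζ ∈ ball (0 : ℂ) μ, ‖F ζ‖ < 1 := fun ζ hζ => by
      rw [hF, norm_mul, norm_real, Real.norm_of_nonneg hρ.1]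
      have := (hfz (g ζ)).trans (hg ζ hζ)
      nlinarith [norm_nonneg (f (g ζ)), hρ.1, hρ.2]
    have hF' : HasDerivAt F (ρ * f g') 0 := (f.hasFDerivAt.comp_hasDerivAt 0 hg').const_mul _
    have h1 := norm_deriv_mul_le_of_norm_lt_one hμ hFd hFn
    rw [hF'.deriv] at h1
    have h2 : (ρ * ‖y‖ : ℂ) = F 0 + ζ * ((μ / 2 : ℝ) * (ρ * f g')) := by
      have : (‖y‖ : ℂ) = f y := hfy.symm
      rw [this, hy, map_add, map_smul, map_smul, smul_eq_mul, smul_eq_mul, hF]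
      ring
    have h3 : ρ * ‖y‖ = ‖F 0 + ζ * ((μ / 2 : ℝ) * (ρ * f g'))‖ := by
      rw [← h2, norm_mul, norm_real, norm_real, norm_norm, Real.norm_of_nonneg hρ.1]
    rw [h3]
    refine (norm_add_le _ _).trans ?_
    have e5 : ‖ζ * ((μ / 2 : ℝ) * (ρ * f g'))‖ = ‖ζ‖ * (μ / 2 * ‖(ρ : ℂ) * f g'‖) := by
      rw [norm_mul, norm_mul ((μ / 2 : ℝ) : ℂ), norm_real, Real.norm_of_nonneg (by positivity)]
    rw [e5]
    have h4 : ‖ζ‖ * (μ / 2 * ‖(ρ : ℂ) * f g'‖) ≤ μ / 2 * ‖(ρ : ℂ) * f g'‖ :=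
      mul_le_of_le_one_left (by positivity) hζ
    have h5 := hFn 0 (mem_ball_self hμ)
    nlinarith [norm_nonneg (F 0)]
  by_contra! hlt
  have hpos : 0 < ‖y‖ := by linarith
  obtain ⟨ρ, h1, h2⟩ := exists_between (inv_lt_one_of_one_lt₀ hlt)
  have := key ρ ⟨(inv_pos.2 hpos).le.trans h1.le, h2⟩
  rw [inv_lt_iff_one_lt_mul₀ hpos] at h1
  linarith

end Schwarz

section Resolvent

variable {Y : Type*} [NormedAddCommGroup Y] [NormedSpace ℂ Y]

theorem algebraMap_sub_eq_neg (B : Y →L[ℂ] Y) (z : ℂ) :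
    algebraMap ℂ (Y →L[ℂ] Y) z - B = -(B - z • ContinuousLinearMap.id ℂ Y) := by
  rw [Algebra.algebraMap_eq_smul_one, ContinuousLinearMap.one_def, neg_sub]

theorem mem_resolventSet_iff_isUnit_sub {B : Y →L[ℂ] Y} {z : ℂ} :
    z ∈ resolventSet ℂ B ↔ IsUnit (B - z • ContinuousLinearMap.id ℂ Y) := by
  rw [spectrum.mem_resolventSet_iff, algebraMap_sub_eq_neg, IsUnit.neg_iff]

theorem norm_resolvent_le {B : Y →L[ℂ] Y} {z : ℂ} {η : ℝ} (hη : 0 < η)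
    (hu : IsUnit (B - z • ContinuousLinearMap.id ℂ Y))
    (hb : ∀ x, η * ‖x‖ ≤ ‖(B - z • ContinuousLinearMap.id ℂ Y) x‖) :
    ‖resolvent B z‖ ≤ η⁻¹ := by
  rw [resolvent, algebraMap_sub_eq_neg, norm_inverse_le_iff (IsUnit.neg_iff _ |>.2 hu) hη]
  intro x
  rw [neg_apply, norm_neg]
  exact hb x

theorem mul_resolvent_zero {B : Y →L[ℂ] Y} (h : (0 : ℂ) ∈ resolventSet ℂ B) :
    B * resolvent B (0 : ℂ) = -1 ∧ resolvent B (0 : ℂ) * B = -1 := by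
  have hu : IsUnit (-B) := by
    rw [spectrum.mem_resolventSet_iff, map_zero, zero_sub] at h; exact h
  have h1 := Ring.mul_inverse_cancel _ hu
  have h2 := Ring.inverse_mul_cancel _ hu
  rw [resolvent, map_zero, zero_sub]
  exact ⟨by rw [← h1, neg_mul, neg_neg], by rw [← h2, mul_neg, neg_neg]⟩

/-- In a complex uniformly convex space a bounded analytic orbit of the resolvent stays away from
its bound. -/
theorem exists_orbit_bound {Z : Type*} [NormedAddCommGroup Z] [NormedSpace ℂ Z]
    (hZ : ComplexUniformlyConvex Z) [CompleteSpace Y] {η μ M : ℝ} (hη : 0 < η) (hμ : 0 < μ)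
    (hM : 0 < M) : ∃ q : ℝ, 0 < q ∧ q < 1 ∧ ∀ (B : Y →L[ℂ] Y) (L : (Y →L[ℂ] Y) →L[ℂ] Z),
      (∀ T, ‖L T‖ ≤ η * ‖T‖) → ‖L (resolvent B (0 : ℂ))‖ ≤ M * ‖L (resolvent B (0 : ℂ) ^ 2)‖ →
      (∀ ζ : ℂ, ‖ζ‖ < μ → IsUnit (B - ζ • ContinuousLinearMap.id ℂ Y) ∧
        ∀ x, η * ‖x‖ ≤ ‖(B - ζ • ContinuousLinearMap.id ℂ Y) x‖) →
      ‖L (resolvent B (0 : ℂ))‖ ≤ q := by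
  -- A value of norm at least `1/2` forces a derivative of norm at least `1 / (2M)`; the factor `μ /
  -- 2` gives `μ / (4M)`. Smaller values are covered by the `1/2` in `q`.
  obtain ⟨δ, hδ, H⟩ := hZ (μ / (4 * M)) (by positivity)
  refine ⟨max (1 / 2) (1 - δ), by positivity, max_lt (by norm_num) (by linarith), ?_⟩
  intro B L hL hLM hB
  rcases le_total ‖L (resolvent B (0 : ℂ))‖ (1 / 2) with h | h
  · exact h.trans (le_max_left _ _)
  refine le_trans ?_ (le_max_right _ _)
  have hres : ∀ ζ ∈ Metric.ball (0 : ℂ) μ, ζ ∈ resolventSet ℂ B := fun ζ hζ =>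
    mem_resolventSet_iff_isUnit_sub.2 (hB ζ (by simpa using hζ)).1
  have hder : ∀ ζ ∈ Metric.ball (0 : ℂ) μ,
      HasDerivAt (fun ζ => L (resolvent B ζ)) (L (-resolvent B ζ ^ 2)) ζ := fun ζ hζ =>
    L.hasFDerivAt.comp_hasDerivAt ζ (spectrum.hasDerivAt_resolvent_const_left (hres ζ hζ))
  refine H _ (((μ / 2 : ℝ) : ℂ) • L (-resolvent B (0 : ℂ) ^ 2)) ?_ fun ζ hζ => ?_
  · rw [map_neg, norm_smul, norm_neg, Complex.norm_real, Real.norm_of_nonneg (by positivity)]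
    rw [div_le_iff₀ (by positivity)]
    nlinarith
  · refine norm_add_smul_deriv_le_one (g := fun ζ => L (resolvent B ζ)) hμ
      (fun ζ hζ => (hder ζ hζ).differentiableAt.differentiableWithinAt)
      (hder 0 (Metric.mem_ball_self hμ)) (fun ζ hζ => ?_) hζ
    have hb := hB ζ (by simpa using hζ)
    calc ‖L (resolvent B ζ)‖ ≤ η * ‖resolvent B ζ‖ := hL _
      _ ≤ η * η⁻¹ := mul_le_mul_of_nonneg_left (norm_resolvent_le hη hb.1 hb.2) hη.le
      _ = 1 := mul_inv_cancel₀ hη.ne'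

/-- The orbit is the resolvent applied to `B x` rescaled to norm `η`, whose value at `0` is a
multiple of `x`. The derivative bound comes from `R = -B R²` and `‖B‖ ≤ M`. -/
theorem exists_gap_of_complexUniformlyConvex [CompleteSpace Y] (hY : ComplexUniformlyConvex Y)
    {η μ M : ℝ} (hη : 0 < η) (hμ : 0 < μ) (hM : 0 < M) :
    ∃ η', η < η' ∧ ∀ B : Y →L[ℂ] Y, ‖B‖ ≤ M →
      (∀ ζ : ℂ, ‖ζ‖ < μ → IsUnit (B - ζ • ContinuousLinearMap.id ℂ Y) ∧
        ∀ x, η * ‖x‖ ≤ ‖(B - ζ • ContinuousLinearMap.id ℂ Y) x‖) →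
      ∀ x, η' * ‖x‖ ≤ ‖B x‖ := by
  obtain ⟨q, q0, q1, H⟩ := exists_orbit_bound (Y := Y) hY hη hμ hM
  refine ⟨η / q, by rw [lt_div_iff₀ q0]; nlinarith, fun B hBM hB x => ?_⟩
  have h0 : (0 : ℂ) ∈ resolventSet ℂ B :=
    mem_resolventSet_iff_isUnit_sub.2 (hB 0 (by simpa using hμ)).1
  obtain ⟨e1, e2⟩ := mul_resolvent_zero h0
  rcases (norm_nonneg (B x)).eq_or_lt with hBx | hBx
  · have := (hB 0 (by simpa using hμ)).2 x
    rw [zero_smul, sub_zero, ← hBx] at this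
    have hx : ‖x‖ = 0 := le_antisymm (by nlinarith) (norm_nonneg x)
    rw [hx, mul_zero]; exact hBx.le
  set c : ℂ := ((η / ‖B x‖ : ℝ) : ℂ) with hc
  have hcn : ‖c‖ = η / ‖B x‖ := by rw [hc, Complex.norm_real, Real.norm_of_nonneg (by positivity)]
  set L : (Y →L[ℂ] Y) →L[ℂ] Y := ContinuousLinearMap.apply ℂ Y (c • B x) with hLdef
  have hL : ∀ T, L T = T (c • B x) := fun _ => rfl
  have h := H B L (fun T => ?_) ?_ hB
  · have e3 : resolvent B (0 : ℂ) (B x) = -x := congrArg (fun T : Y →L[ℂ] Y => T x) e2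
    rw [hL, map_smul, e3, norm_smul, norm_neg, hcn, div_mul_eq_mul_div, div_le_iff₀ hBx] at h
    rw [div_mul_eq_mul_div, div_le_iff₀ q0]; linarith
  · rw [hL]
    have : ‖c • B x‖ = η := by rw [norm_smul, hcn]; field_simp
    have h1 := T.le_opNorm (c • B x)
    rw [this] at h1; linarith
  · have e4 : L (resolvent B (0 : ℂ)) = -B (L (resolvent B (0 : ℂ) ^ 2)) := by
      have : B * resolvent B (0 : ℂ) ^ 2 = -resolvent B (0 : ℂ) := by
        rw [pow_two, ← mul_assoc, e1, neg_one_mul]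
      have := congrArg (fun T : Y →L[ℂ] Y => T (c • B x)) this
      simp only [mul_apply_eq_comp, neg_apply] at this
      rw [hL, hL, this, neg_neg]
    rw [e4, norm_neg]
    exact B.le_of_opNorm_le hBM _

/-- The same argument on the dual side: the orbit is `η f ∘ R(ζ)` with `f` norming `x`, and `B` now
multiplies from the right. -/
theorem exists_gap_of_complexUniformlyConvex_dual [CompleteSpace Y]
    (hY : ComplexUniformlyConvex (StrongDual ℂ Y))
    {η μ M : ℝ} (hη : 0 < η) (hμ : 0 < μ) (hM : 0 < M) :
    ∃ η', η < η' ∧ ∀ B : Y →L[ℂ] Y, ‖B‖ ≤ M →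
      (∀ ζ : ℂ, ‖ζ‖ < μ → IsUnit (B - ζ • ContinuousLinearMap.id ℂ Y) ∧
        ∀ x, η * ‖x‖ ≤ ‖(B - ζ • ContinuousLinearMap.id ℂ Y) x‖) →
      ∀ x, η' * ‖x‖ ≤ ‖B x‖ := by
  obtain ⟨q, q0, q1, H⟩ := exists_orbit_bound (Y := Y) hY hη hμ hM
  refine ⟨η / q, by rw [lt_div_iff₀ q0]; nlinarith, fun B hBM hB x => ?_⟩
  have h0 : (0 : ℂ) ∈ resolventSet ℂ B :=
    mem_resolventSet_iff_isUnit_sub.2 (hB 0 (by simpa using hμ)).1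
  obtain ⟨e1, e2⟩ := mul_resolvent_zero h0
  obtain ⟨f, hf, hfx⟩ := exists_dual_vector'' ℂ x
  set L : (Y →L[ℂ] Y) →L[ℂ] StrongDual ℂ Y :=
    ContinuousLinearMap.compL ℂ Y Y ℂ ((η : ℂ) • f) with hLdef
  have hL : ∀ T, L T = ((η : ℂ) • f).comp T := fun _ => rfl
  have hfn : ‖(η : ℂ) • f‖ ≤ η := by
    rw [norm_smul, Complex.norm_real, Real.norm_of_nonneg hη.le]
    exact mul_le_of_le_one_right hη.le hf
  have h := H B L (fun T => ?_) ?_ hB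
  · have e3 : resolvent B (0 : ℂ) (B x) = -x := congrArg (fun T : Y →L[ℂ] Y => T x) e2
    have h1 := (L (resolvent B (0 : ℂ))).le_of_opNorm_le h (B x)
    have e6 : L (resolvent B (0 : ℂ)) (B x) = (η : ℂ) * f (resolvent B (0 : ℂ) (B x)) := rfl
    have e7 : ‖L (resolvent B (0 : ℂ)) (B x)‖ = η * ‖x‖ := by
      rw [e6, e3, map_neg, hfx, norm_mul, norm_neg, Complex.norm_real, Real.norm_of_nonneg hη.le]
      simp
    rw [e7] at h1
    rw [div_mul_eq_mul_div, div_le_iff₀ q0]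
    linarith
  · exact (ContinuousLinearMap.opNorm_comp_le _ _).trans
      (mul_le_mul_of_nonneg_right hfn (norm_nonneg _))
  · have e4 : L (resolvent B (0 : ℂ)) = -(L (resolvent B (0 : ℂ) ^ 2)).comp B := by
      have : resolvent B (0 : ℂ) ^ 2 * B = -resolvent B (0 : ℂ) := by
        rw [pow_two, mul_assoc, e2, mul_neg_one]
      have e5 : (L (resolvent B (0 : ℂ) ^ 2)).comp B = L (resolvent B (0 : ℂ) ^ 2 * B) := rfl
      rw [e5, this, map_neg, neg_neg]
    rw [e4, norm_neg, mul_comm]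
    exact (ContinuousLinearMap.opNorm_comp_le _ _).trans
      (mul_le_mul_of_nonneg_left hBM (norm_nonneg _))

end Resolvent

/-! ### Complex uniform convexity of `ℓ²` sums -/

section UniformConvexity

theorem ComplexUniformlyConvex.of_linearIsometry {Z W : Type*} [NormedAddCommGroup Z]
    [NormedSpace ℂ Z] [NormedAddCommGroup W] [NormedSpace ℂ W] (hW : ComplexUniformlyConvex W)
    (T : Z →ₗᵢ[ℂ] W) : ComplexUniformlyConvex Z := by
  intro ε hε
  obtain ⟨δ, hδ, H⟩ := hW ε hε
  refine ⟨δ, hδ, fun x y hy h => ?_⟩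
  rw [← T.norm_map x]
  refine H _ (T y) (by rwa [T.norm_map]) fun ζ hζ => ?_
  rw [← map_smul, ← map_add, T.norm_map]
  exact h ζ hζ

variable {X : Type*} [NormedAddCommGroup X] [NormedSpace ℂ X]

/-- In an `ℓ²` sum, a disc in the unit ball whose centre is almost of norm one has almost minimal
radius in every coordinate. -/
theorem norm_coord_add_le {n : ℕ} {x w : PiLp 2 (fun _ : Fin n => X)} (hp : ‖x + w‖ ≤ 1)
    (hm : ‖x - w‖ ≤ 1) (i : Fin n) : ‖x i + w i‖ ≤ ‖x i‖ + 2 * √(1 - ‖x‖ ^ 2) := by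
  have hx : 2 * ‖x‖ ≤ ‖x + w‖ + ‖x - w‖ := by
    have := norm_add_le (x + w) (x - w)
    rwa [add_add_sub_cancel, ← two_smul ℝ x, norm_smul, Real.norm_two] at this
  have htau : 0 ≤ 1 - ‖x‖ ^ 2 := by nlinarith [norm_nonneg x]
  have hl : ∀ l, 2 * ‖x l‖ ≤ ‖x l + w l‖ + ‖x l - w l‖ := fun l => by
    have := norm_add_le (x l + w l) (x l - w l)
    rwa [add_add_sub_cancel, ← two_smul ℝ (x l), norm_smul, Real.norm_two] at this
  -- These parallelogram defects are nonnegative coordinate by coordinate, so each one is bounded by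
  -- their sum.
  have hD : ∀ l, 0 ≤ ‖x l + w l‖ ^ 2 + ‖x l - w l‖ ^ 2 - 2 * ‖x l‖ ^ 2 := fun l => by
    nlinarith [hl l, sq_nonneg (‖x l + w l‖ - ‖x l - w l‖), norm_nonneg (x l)]
  have hsum : ∑ l, (‖x l + w l‖ ^ 2 + ‖x l - w l‖ ^ 2 - 2 * ‖x l‖ ^ 2) ≤ 2 * (1 - ‖x‖ ^ 2) := by
    rw [Finset.sum_sub_distrib, Finset.sum_add_distrib, ← Finset.mul_sum]
    have e1 := PiLp.norm_sq_eq_of_L2 _ (x + w)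
    have e2 := PiLp.norm_sq_eq_of_L2 _ (x - w)
    have e3 := PiLp.norm_sq_eq_of_L2 _ x
    simp only [PiLp.add_apply, PiLp.sub_apply] at e1 e2
    rw [← e1, ← e2, ← e3]
    nlinarith [norm_nonneg (x + w), norm_nonneg (x - w)]
  have hi := (Finset.single_le_sum (fun l _ => hD l) (Finset.mem_univ i)).trans hsum
  set t := √(1 - ‖x‖ ^ 2) with ht
  have ht2 : t ^ 2 = 1 - ‖x‖ ^ 2 := Real.sq_sqrt htau
  have ht0 : 0 ≤ t := Real.sqrt_nonneg _
  rw [← ht2] at hi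
  have h1 := hl i
  have h0 := norm_nonneg (x i)
  set p := ‖x i + w i‖
  set q := ‖x i - w i‖
  have h2 : p - q ≤ 2 * t := by
    refine abs_le_of_sq_le_sq' ?_ (by positivity) |>.2
    nlinarith
  have h3 : p + q ≤ 2 * ‖x i‖ + 2 * t := by
    refine abs_le_of_sq_le_sq' ?_ (by positivity) |>.2
    nlinarith [sq_nonneg (p - q), mul_nonneg h0 ht0]
  linarith

/-- Some coordinate of `y` is at least `ε / (n + 1)`. There the disc lies in the ball of radius `K =
‖x i‖ + 2t`, `t = √(1 - ‖x‖²)`, and convexity of `X`, rescaled by `K ≤ 3`, gives `δ K ≤ 2t`. Thus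
`t` is bounded below, and `‖x‖` stays away from `1`. -/
theorem ComplexUniformlyConvex.piLp (hX : ComplexUniformlyConvex X) (n : ℕ) :
    ComplexUniformlyConvex (PiLp 2 (fun _ : Fin n => X)) := by
  intro ε hε
  set ε₁ := ε / (n + 1) with hε₁
  have hε₁0 : 0 < ε₁ := by positivity
  obtain ⟨δ, hδ, H⟩ := hX (ε₁ / 3) (by positivity)
  set κ := δ * ε₁ / (2 * (1 + δ)) with hκ
  have hκ0 : 0 < κ := by positivity
  refine ⟨κ ^ 2 / 2, by positivity, fun x y hy h => ?_⟩
  have hx1 : ‖x‖ ≤ 1 := by simpa using h 0 (by simp)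
  have htau : 0 ≤ 1 - ‖x‖ ^ 2 := by nlinarith [norm_nonneg x]
  obtain ⟨i, hi⟩ : ∃ i, ε₁ ≤ ‖y i‖ := by
    by_contra! hlt
    have h1 : ‖y‖ ^ 2 ≤ n * ε₁ ^ 2 := by
      rw [PiLp.norm_sq_eq_of_L2]
      refine (Finset.sum_le_sum fun i _ =>
        pow_le_pow_left₀ (norm_nonneg _) (hlt i).le 2).trans ?_
      simp
    have h2 : ε = (n + 1) * ε₁ := by rw [hε₁]; field_simp
    have h3 : ε ^ 2 ≤ ‖y‖ ^ 2 := pow_le_pow_left₀ hε.le hy 2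
    rw [h2] at h3
    have hn : (0 : ℝ) ≤ n := Nat.cast_nonneg n
    nlinarith [sq_nonneg ε₁, mul_pos hε₁0 hε₁0, mul_nonneg hn hn]
  set t := √(1 - ‖x‖ ^ 2) with ht
  have ht2 : t ^ 2 = 1 - ‖x‖ ^ 2 := Real.sq_sqrt htau
  have ht0 : 0 ≤ t := Real.sqrt_nonneg _
  have ht1 : t ≤ 1 := by nlinarith [norm_nonneg x]
  have hxi : ‖x i‖ ≤ 1 := (PiLp.norm_apply_le x i).trans hx1
  set K := ‖x i‖ + 2 * t with hK
  have hball : ∀ ζ : ℂ, ‖ζ‖ ≤ 1 → ‖x i + ζ • y i‖ ≤ K := fun ζ hζ =>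
    norm_coord_add_le (w := ζ • y) (h ζ hζ)
      (by rw [sub_eq_add_neg, ← neg_smul]; exact h (-ζ) (by rwa [norm_neg])) i
  have hyK : ‖y i‖ ≤ K := by
    have h1 := hball 1 (by simp)
    have h2 := hball (-1) (by simp)
    have h3 := norm_sub_le (x i + (1 : ℂ) • y i) (x i + (-1 : ℂ) • y i)
    have h4 : x i + (1 : ℂ) • y i - (x i + (-1 : ℂ) • y i) = (2 : ℝ) • y i := by
      rw [two_smul, one_smul, neg_smul, one_smul]; abel
    rw [h4, norm_smul, Real.norm_two] at h3
    linarith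
  have hK0 : 0 < K := hε₁0.trans_le (hi.trans hyK)
  have hK3 : K ≤ 3 := by linarith
  have hcK : ‖((K⁻¹ : ℝ) : ℂ)‖ = K⁻¹ := by
    rw [Complex.norm_real, Real.norm_of_nonneg (by positivity)]
  have hmain := H (((K⁻¹ : ℝ) : ℂ) • x i) (((K⁻¹ : ℝ) : ℂ) • y i) ?_ fun ζ hζ => ?_
  · rw [norm_smul, hcK, inv_mul_eq_div, div_le_iff₀ hK0] at hmain
    have h1 : δ * K ≤ 2 * t := by linarith
    have h2 : κ ≤ t := by
      rw [hκ, div_le_iff₀ (by positivity)]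
      have : δ * ε₁ ≤ δ * K := mul_le_mul_of_nonneg_left (hi.trans hyK) hδ.le
      nlinarith
    have h3 : κ ^ 2 ≤ t ^ 2 := pow_le_pow_left₀ hκ0.le h2 2
    nlinarith [sq_nonneg (1 - ‖x‖)]
  · rw [norm_smul, hcK, inv_mul_eq_div, div_le_div_iff₀ (by norm_num) hK0]
    nlinarith
  · rw [smul_comm, ← smul_add, norm_smul, hcK, inv_mul_eq_div, div_le_one hK0]
    exact hball ζ hζ

/-- The dual of an `ℓ²` sum embeds isometrically into the `ℓ²` sum of the duals. -/
noncomputable def dualPiLpIsometry (n : ℕ) :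
    StrongDual ℂ (PiLp 2 (fun _ : Fin n => X)) →ₗᵢ[ℂ] PiLp 2 (fun _ : Fin n => StrongDual ℂ X) where
  toFun f := WithLp.toLp 2 fun i => f.comp (singleL i)
  map_add' _ _ := rfl
  map_smul' _ _ := rfl
  norm_map' f := by
    refine (pow_left_inj₀ (norm_nonneg _) (norm_nonneg _) two_ne_zero).1 ?_
    rw [← norm_sq_dual_piLp, PiLp.norm_sq_eq_of_L2]
    rfl

end UniformConvexity

end TauMethod

namespace TauMethod

/-! ### The finite-dimensional case -/

section FiniteDimensional

open Filter Topology

variable {Y : Type*} [NormedAddCommGroup Y] [NormedSpace ℂ Y] [FiniteDimensional ℂ Y]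

theorem isUnit_iff_isUnit_toLinearMap {B : Y →L[ℂ] Y} :
    IsUnit B ↔ IsUnit (B : Module.End ℂ Y) := by
  have := FiniteDimensional.complete ℂ Y
  rw [ContinuousLinearMap.isUnit_iff_bijective, Module.End.isUnit_iff]
  rfl

theorem spectrum_eq_spectrum_toLinearMap (B : Y →L[ℂ] Y) :
    spectrum ℂ B = spectrum ℂ (B : Module.End ℂ Y) := by
  ext z
  rw [spectrum.mem_iff, spectrum.mem_iff, isUnit_iff_isUnit_toLinearMap]
  rfl

theorem pow_card_le_norm_prod {μ : ℝ} (hμ : 0 ≤ μ) (s : Multiset ℂ) (h : ∀ r ∈ s, μ ≤ ‖r‖) :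
    μ ^ Multiset.card s ≤ ‖s.prod‖ := by
  induction s using Multiset.induction with
  | empty => simp
  | cons a s ih =>
    rw [Multiset.card_cons, Multiset.prod_cons, norm_mul, pow_succ']
    exact mul_le_mul (h a (Multiset.mem_cons_self a s))
      (ih fun r hr => h r (Multiset.mem_cons_of_mem hr)) (by positivity) (norm_nonneg _)

/-- The determinant is the product of the eigenvalues, all at distance at least `μ` from `0`. -/
theorem pow_finrank_le_norm_det {B : Y →L[ℂ] Y} {μ : ℝ} (hμ : 0 ≤ μ)
    (hB : ∀ ζ : ℂ, ‖ζ‖ < μ → IsUnit (B - ζ • ContinuousLinearMap.id ℂ Y)) :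
    μ ^ Module.finrank ℂ Y ≤ ‖B.det‖ := by
  have hs := IsAlgClosed.splits (B : Module.End ℂ Y).charpoly
  have e : B.det = (B : Module.End ℂ Y).charpoly.roots.prod :=
    Module.End.det_eq_prod_roots_charpoly_of_splits hs
  rw [e, ← LinearMap.charpoly_natDegree (B : Module.End ℂ Y), hs.natDegree_eq_card_roots]
  refine pow_card_le_norm_prod hμ _ fun r hr => ?_
  by_contra! hlt
  have h1 : r ∈ spectrum ℂ (B : Module.End ℂ Y) :=
    (Module.End.mem_spectrum_iff_isRoot_charpoly _ _).2 (Polynomial.isRoot_of_mem_roots hr)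
  rw [← spectrum_eq_spectrum_toLinearMap] at h1
  exact h1 (mem_resolventSet_iff_isUnit_sub.2 (hB r hlt))

theorem isPreconnected_resolventSet (B : Y →L[ℂ] Y) : IsPreconnected (resolventSet ℂ B) := by
  have h : (spectrum ℂ B).Countable := by
    rw [spectrum_eq_spectrum_toLinearMap]
    exact (Module.End.finite_spectrum _).countable
  have := h.isConnected_compl_of_one_lt_rank (by rw [Complex.rank_real_complex]; norm_num)
  rw [spectrum, compl_compl] at this
  exact this.isPreconnected

/-- The norm of the resolvent of a matrix has no local maximum. -/
theorem not_forall_bounded_below {B : Y →L[ℂ] Y} {η μ : ℝ} (hη : 0 < η) (hμ : 0 < μ)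
    (hB : ∀ ζ : ℂ, ‖ζ‖ < μ → ∀ x, η * ‖x‖ ≤ ‖(B - ζ • ContinuousLinearMap.id ℂ Y) x‖)
    {x : Y} (hx : ‖x‖ = 1) : η < ‖B x‖ := by
  have := FiniteDimensional.complete ℂ Y
  have : Nontrivial Y := ⟨x, 0, by rintro rfl; simp at hx⟩
  by_contra! hle
  have hu : ∀ ζ : ℂ, ‖ζ‖ < μ → IsUnit (B - ζ • ContinuousLinearMap.id ℂ Y) := fun ζ hζ =>
    isUnit_of_bounded_below_of_finiteDimensional hη (hB ζ hζ)
  have hres : ∀ ζ ∈ Metric.ball (0 : ℂ) μ, ζ ∈ resolventSet ℂ B := fun ζ hζ =>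
    mem_resolventSet_iff_isUnit_sub.2 (hu ζ (by simpa using hζ))
  have h0 := hres 0 (Metric.mem_ball_self hμ)
  obtain ⟨f, hf, hfx⟩ := exists_dual_vector'' ℂ x
  set L : (Y →L[ℂ] Y) →L[ℂ] ℂ := f.comp (ContinuousLinearMap.apply ℂ Y (B x)) with hLdef
  have hL : ∀ T, L T = f (T (B x)) := fun _ => rfl
  -- If `‖B x‖ ≤ η`, this scalar function attains its maximum modulus over the disc at `0`. It is
  -- then constant near `0`, hence on the connected resolvent set, although it decays at infinity.
  set g : ℂ → ℂ := fun ζ => L (resolvent B ζ) with hg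
  have hder : ∀ ζ ∈ resolventSet ℂ B, DifferentiableAt ℂ g ζ := fun ζ hζ =>
    (L.hasFDerivAt.comp_hasDerivAt ζ
      (spectrum.hasDerivAt_resolvent_const_left hζ)).differentiableAt
  have hg0 : g 0 = -1 := by
    have e3 : resolvent B (0 : ℂ) (B x) = -x :=
      congrArg (fun T : Y →L[ℂ] Y => T x) (mul_resolvent_zero h0).2
    rw [hg]
    simp only [hL, e3, map_neg, hfx, hx]
    simp
  have hg1 : ∀ ζ ∈ Metric.ball (0 : ℂ) μ, ‖g ζ‖ ≤ 1 := by
    intro ζ hζ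
    have hζ' : ‖ζ‖ < μ := by simpa using hζ
    have h1 := norm_resolvent_le hη (hu ζ hζ') (hB ζ hζ')
    calc ‖g ζ‖ ≤ 1 * ‖resolvent B ζ (B x)‖ := f.le_of_opNorm_le hf _
      _ ≤ 1 * (η⁻¹ * η) := by
        rw [one_mul, one_mul]
        exact ((resolvent B ζ).le_of_opNorm_le h1 _).trans
          (mul_le_mul_of_nonneg_left hle (by positivity))
      _ = 1 := by rw [one_mul, inv_mul_cancel₀ hη.ne']
  have hball : Metric.ball (0 : ℂ) μ ∈ 𝓝 (0 : ℂ) := Metric.ball_mem_nhds 0 hμ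
  have hev : g =ᶠ[𝓝 0] fun _ => -1 := by
    rw [← hg0]
    refine Complex.eventually_eq_of_isLocalMax_norm
      (by filter_upwards [hball] with ζ hζ using hder ζ (hres ζ hζ)) ?_
    filter_upwards [hball] with ζ hζ
    simp only [Function.comp_apply, hg0, norm_neg, norm_one]
    exact hg1 ζ hζ
  have hopen : IsOpen (resolventSet ℂ B) := spectrum.isOpen_resolventSet B
  have hEq : Set.EqOn g (fun _ => -1) (resolventSet ℂ B) :=
    AnalyticOnNhd.eqOn_of_preconnected_of_eventuallyEq (𝕜 := ℂ)
      (DifferentiableOn.analyticOnNhd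
        (fun ζ hζ => (hder ζ hζ).differentiableWithinAt) hopen)
      analyticOnNhd_const (isPreconnected_resolventSet B) h0 hev
  have ht : Tendsto g (Bornology.cobounded ℂ) (𝓝 0) := by
    have := (L.continuous.tendsto 0).comp (spectrum.resolvent_tendsto_cobounded (𝕜 := ℂ) B)
    rwa [map_zero] at this
  have hres_ev : ∀ᶠ ζ in Bornology.cobounded ℂ, ζ ∈ resolventSet ℂ B := by
    have hb : Bornology.IsBounded (spectrum ℂ B) := spectrum.isBounded B
    filter_upwards [Bornology.isBounded_def.1 hb] with ζ hζ
    simpa [spectrum] using hζ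
  have ht' : Tendsto g (Bornology.cobounded ℂ) (𝓝 (-1)) :=
    tendsto_const_nhds.congr' (hres_ev.mono fun ζ hζ => (hEq hζ).symm)
  have := tendsto_nhds_unique ht ht'
  simp at this

/-- Without a gap, a limit of counterexamples is a `B` with a unit vector satisfying `‖B x‖ ≤ η`.
For `η > 0` the limiting lower bounds contradict `not_forall_bounded_below`; for `η = 0` they are
vacuous, and the determinant bound is what survives the limit. -/
theorem exists_gap_of_finiteDimensional {η μ M : ℝ} (hη : 0 ≤ η) (hμ : 0 < μ) :
    ∃ η', η < η' ∧ ∀ B : Y →L[ℂ] Y, ‖B‖ ≤ M →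
      (∀ ζ : ℂ, ‖ζ‖ < μ → IsUnit (B - ζ • ContinuousLinearMap.id ℂ Y) ∧
        ∀ x, η * ‖x‖ ≤ ‖(B - ζ • ContinuousLinearMap.id ℂ Y) x‖) →
      ∀ x, η' * ‖x‖ ≤ ‖B x‖ := by
  have := FiniteDimensional.complete ℂ Y
  have : ProperSpace Y := FiniteDimensional.proper ℂ Y
  have : ProperSpace (Y →L[ℂ] Y) := FiniteDimensional.proper ℂ _
  by_contra! hcon
  have hseq : ∀ j : ℕ, ∃ p : (Y →L[ℂ] Y) × Y, ‖p.1‖ ≤ M ∧ ‖p.2‖ = 1 ∧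
      (∀ ζ : ℂ, ‖ζ‖ < μ → IsUnit (p.1 - ζ • ContinuousLinearMap.id ℂ Y) ∧
        ∀ x, η * ‖x‖ ≤ ‖(p.1 - ζ • ContinuousLinearMap.id ℂ Y) x‖) ∧
      ‖p.1 p.2‖ ≤ η + 1 / ((j : ℝ) + 1) := by
    intro j
    obtain ⟨B, hM, hB, x, hx⟩ := hcon (η + 1 / ((j : ℝ) + 1))
      (lt_add_of_pos_right _ (by positivity))
    have hx0 : 0 < ‖x‖ := by
      rcases (norm_nonneg x).eq_or_lt with h | h
      · rw [← h, mul_zero] at hx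
        exact absurd hx (norm_nonneg _).not_gt
      · exact h
    have hc : ‖((‖x‖⁻¹ : ℝ) : ℂ)‖ = ‖x‖⁻¹ := by
      rw [Complex.norm_real, Real.norm_of_nonneg (by positivity)]
    refine ⟨(B, ((‖x‖⁻¹ : ℝ) : ℂ) • x), hM, ?_, hB, ?_⟩
    · rw [norm_smul, hc, inv_mul_cancel₀ hx0.ne']
    · rw [map_smul, norm_smul, hc, inv_mul_eq_div, div_le_iff₀ hx0]
      exact hx.le
  choose p hpM hp1 hpB hpη using hseq
  have hcompact : IsCompact (Metric.closedBall (0 : Y →L[ℂ] Y) M ×ˢ Metric.sphere (0 : Y) 1) :=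
    (isCompact_closedBall _ _).prod (isCompact_sphere _ _)
  obtain ⟨⟨B, x⟩, hBx, φ, hφ, hlim⟩ := hcompact.tendsto_subseq (x := p)
    fun j => ⟨by simpa using hpM j, by simpa using hp1 j⟩
  have hx1 : ‖x‖ = 1 := by simpa using hBx.2
  have hlim1 : Tendsto (fun j => (p (φ j)).1) atTop (𝓝 B) := (continuous_fst.tendsto _).comp hlim
  have hlim2 : Tendsto (fun j => (p (φ j)).2) atTop (𝓝 x) := (continuous_snd.tendsto _).comp hlim
  have hBle : ‖B x‖ ≤ η := by
    have h1 : Tendsto (fun j => ‖(p (φ j)).1 (p (φ j)).2‖) atTop (𝓝 ‖B x‖) :=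
      ((isBoundedBilinearMap_apply.continuous.tendsto (B, x)).comp
        (hlim1.prodMk_nhds hlim2)).norm
    have h2 : Tendsto (fun j => η + 1 / (((φ j : ℕ) : ℝ) + 1)) atTop (𝓝 (η + 0)) :=
      tendsto_const_nhds.add (tendsto_one_div_add_atTop_nhds_zero_nat.comp hφ.tendsto_atTop)
    rw [add_zero] at h2
    exact le_of_tendsto_of_tendsto' h1 h2 fun j => hpη (φ j)
  rcases hη.eq_or_lt with rfl | hη
  · have hdet : μ ^ Module.finrank ℂ Y ≤ ‖B.det‖ := by
      refine ge_of_tendsto' (((ContinuousLinearMap.continuous_det (𝕜 := ℂ)).tendsto B).comp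
        hlim1).norm fun j => ?_
      exact pow_finrank_le_norm_det hμ.le fun ζ hζ => (hpB (φ j) ζ hζ).1
    have hdet0 : LinearMap.det (B : Y →ₗ[ℂ] Y) ≠ 0 := by
      intro h
      have : B.det = 0 := h
      rw [this, norm_zero] at hdet
      exact absurd hdet (by positivity : (0 : ℝ) < μ ^ Module.finrank ℂ Y).not_ge
    have hBx0 : B x = 0 := norm_le_zero_iff.1 hBle
    have hx0 : x = 0 := by
      rw [Ne, LinearMap.det_eq_zero_iff_ker_ne_bot, not_not] at hdet0
      exact LinearMap.ker_eq_bot'.1 hdet0 x hBx0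
    rw [hx0, norm_zero] at hx1
    exact zero_ne_one hx1
  · refine (not_forall_bounded_below hη hμ (B := B) (fun ζ hζ v => ?_) hx1).not_ge hBle
    have h1 : Tendsto (fun j => ‖((p (φ j)).1 - ζ • ContinuousLinearMap.id ℂ Y) v‖) atTop
        (𝓝 ‖(B - ζ • ContinuousLinearMap.id ℂ Y) v‖) :=
      (((ContinuousLinearMap.apply ℂ Y v).continuous.tendsto _).comp (hlim1.sub_const _)).norm
    exact ge_of_tendsto' h1 fun j => (hpB (φ j) ζ hζ).2 v

end FiniteDimensional

/-! ### The inclusion for closed pseudospectra -/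

theorem sub_add_smul_id {Y : Type*} [NormedAddCommGroup Y] [NormedSpace ℂ Y] (B : Y →L[ℂ] Y)
    (z ζ : ℂ) : B - (z + ζ) • ContinuousLinearMap.id ℂ Y =
      B - z • ContinuousLinearMap.id ℂ Y - ζ • ContinuousLinearMap.id ℂ Y := by
  rw [add_smul, sub_sub]

theorem sub_zero_smul_id {Y : Type*} [NormedAddCommGroup Y] [NormedSpace ℂ Y] (B : Y →L[ℂ] Y) :
    B - (0 : ℂ) • ContinuousLinearMap.id ℂ Y = B := by
  rw [zero_smul, sub_zero]

section Closed

variable {X : Type*} [NormedAddCommGroup X] [NormedSpace ℂ X]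

theorem norm_singleL {n : ℕ} (i : Fin n) (v : X) : ‖singleL i v‖ = ‖v‖ :=
  PiLp.norm_single 2 (fun _ : Fin n => X) i v

/-- Crude, but independent of `k`, which is what a gap uniform over all sections needs. -/
theorem norm_principalSubmatrix_le (n : ℕ) (k : ℤ) (A : E X →L[ℂ] E X) :
    ‖principalSubmatrix n k A‖ ≤ n * (n * ‖A‖) := by
  refine ContinuousLinearMap.opNorm_le_bound _ (by positivity) fun x => ?_
  have h : ∀ i, ‖principalSubmatrix n k A x i‖ ≤ n * ‖A‖ * ‖x‖ := fun i => by
    rw [principalSubmatrix_apply]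
    refine (norm_sum_le_of_le (f := fun j : Fin n => entry A (k + 1 + (i : ℕ)) (k + 1 + (j : ℕ))
      (x j)) (n := fun _ => ‖A‖ * ‖x‖) _ fun j _ => ?_).trans ?_
    · exact ((entry A _ _).le_of_opNorm_le (norm_entry_le A _ _) _).trans
        (mul_le_mul_of_nonneg_left (PiLp.norm_apply_le x j) (norm_nonneg _))
    · simp [mul_assoc]
  rw [← sum_singleL (principalSubmatrix n k A x)]
  refine (norm_sum_le_of_le (n := fun _ => n * ‖A‖ * ‖x‖) _ fun i _ => ?_).trans ?_
  · rw [norm_singleL]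
    exact h i
  · simp [mul_assoc]

theorem exists_gap_of_globevnikProperty [CompleteSpace X] (hX : GlobevnikProperty X) (n : ℕ)
    {η μ M : ℝ} (hη : 0 ≤ η) (hη' : 0 < η ∨ FiniteDimensional ℂ X) (hμ : 0 < μ) (hM : 0 < M) :
    ∃ η', η < η' ∧ ∀ B : PiLp 2 (fun _ : Fin n => X) →L[ℂ] PiLp 2 (fun _ : Fin n => X), ‖B‖ ≤ M →
      (∀ ζ : ℂ, ‖ζ‖ < μ → IsUnit (B - ζ • ContinuousLinearMap.id ℂ (PiLp 2 fun _ : Fin n => X)) ∧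
        ∀ x, η * ‖x‖ ≤ ‖(B - ζ • ContinuousLinearMap.id ℂ (PiLp 2 fun _ : Fin n => X)) x‖) →
      ∀ x, η' * ‖x‖ ≤ ‖B x‖ := by
  by_cases hfd : FiniteDimensional ℂ X
  · exact exists_gap_of_finiteDimensional hη hμ
  have hη0 : 0 < η := hη'.resolve_right hfd
  rcases hX with h | h | h
  · exact absurd h hfd
  · exact exists_gap_of_complexUniformlyConvex (h.piLp n) hη0 hμ hM
  · exact exists_gap_of_complexUniformlyConvex_dual
      ((h.piLp n).of_linearIsometry (dualPiLpIsometry n)) hη0 hμ hM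

/-- Off the closure, all sections satisfy the bound `ε + ε_n` on a common disc about `z`. The gap
raises it at `z` to one `η' > ε + ε_n` for every `k`, leaving `η' - ε_n > ε` for `A - z`. -/
theorem closedPseudospectrum_subset [CompleteSpace X] (hX : GlobevnikProperty X)
    {A : E X →L[ℂ] E X} (hA : IsTridiagonal A) {n : ℕ} (hn : 1 ≤ n) {ε : ℝ} (hε : 0 ≤ ε)
    (h : 0 < ε ∨ subdiag A ≠ 0 ∨ superdiag A ≠ 0 ∨ FiniteDimensional ℂ X) :
    closedPseudospectrum ε A ⊆ closedTauSet n (ε + penalty n A) A := by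
  have hp : 0 ≤ penalty n A := penaltyOf_nonneg hn _ _
  have hpos : ∀ u : ℤ → (X →L[ℂ] X), BddAbove (Set.range fun j => ‖u j‖) → u ≠ 0 →
      supNorm u ≠ 0 := by
    intro u hu hne h0
    refine hne (funext fun j => norm_le_zero_iff.1 ?_)
    rw [← h0]
    exact le_ciSup hu j
  -- The rescaled orbit argument needs a positive bound; for `ε = 0` it is supplied by a nonzero
  -- off-diagonal, otherwise finite dimension is used.
  have hη' : 0 < ε + penalty n A ∨ FiniteDimensional ℂ X := by
    rcases h with h | h | h | h
    · exact Or.inl (by linarith)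
    · have : 0 < penalty n A := penaltyOf_pos hn (supNorm_nonneg _) (supNorm_nonneg _)
        (Or.inl (hpos _ (bddAbove_norm_entry A (fun j => j + 1) fun j => j) h))
      exact Or.inl (by linarith)
    · have : 0 < penalty n A := penaltyOf_pos hn (supNorm_nonneg _) (supNorm_nonneg _)
        (Or.inr (hpos _ (bddAbove_norm_entry A (fun j => j - 1) fun j => j) h))
      exact Or.inl (by linarith)
    · exact Or.inr h
  intro z hz
  by_contra hnot
  rw [closedTauSet, Metric.mem_closure_iff] at hnot
  push Not at hnot
  obtain ⟨μ, hμ, hdist⟩ := hnot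
  set A' := A - z • ContinuousLinearMap.id ℂ (E X) with hA'
  obtain ⟨η', hlt, H⟩ := exists_gap_of_globevnikProperty hX n (add_nonneg hε hp) hη' hμ
    (M := n * (n * ‖A'‖) + 1) (by positivity)
  have hsec : ∀ k, ∀ ζ : ℂ, ‖ζ‖ < μ → IsUnit (principalSubmatrix n k A' -
      ζ • ContinuousLinearMap.id ℂ (PiLp 2 fun _ : Fin n => X)) ∧
      ∀ x, (ε + penalty n A) * ‖x‖ ≤ ‖(principalSubmatrix n k A' -
        ζ • ContinuousLinearMap.id ℂ (PiLp 2 fun _ : Fin n => X)) x‖ := by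
    intro k ζ hζ
    have hz' : z + ζ ∉ closedPseudospectrum (ε + penalty n A) (principalSubmatrix n k A) := by
      intro hmem
      have := hdist _ (Set.mem_iUnion.2 ⟨k, hmem⟩)
      rw [dist_self_add_right] at this
      linarith
    obtain ⟨m, hm, hu, hb⟩ := (notMem_closedPseudospectrum_iff (add_nonneg hε hp)).1 hz'
    have e : principalSubmatrix n k A - (z + ζ) • ContinuousLinearMap.id ℂ _
        = principalSubmatrix n k A' -
          ζ • ContinuousLinearMap.id ℂ (PiLp 2 fun _ : Fin n => X) := by
      rw [hA', principalSubmatrix_sub_smul]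
      exact sub_add_smul_id _ z ζ
    rw [e] at hu hb
    exact ⟨hu, fun x => (mul_le_mul_of_nonneg_right hm.le (norm_nonneg x)).trans (hb x)⟩
  have hk : ∀ k, IsUnit (principalSubmatrix n k A') ∧
      ∀ x, η' * ‖x‖ ≤ ‖principalSubmatrix n k A' x‖ := fun k =>
    ⟨by
      have hu := (hsec k 0 (by simpa using hμ)).1
      rwa [sub_zero_smul_id] at hu,
      H _ ((norm_principalSubmatrix_le n k A').trans (by linarith)) (hsec k)⟩
  have hpen : penalty n A' = penalty n A := penalty_sub_smul n A z
  refine (notMem_closedPseudospectrum_iff hε).2 ⟨η' - penalty n A, by linarith, ?_, ?_⟩ hz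
  · exact isUnit_of_sections (hA.sub_smul z) hn (m := η') (by rw [hpen]; linarith) hk
  · rw [← hpen]
    exact bounded_below_of_sections (hA.sub_smul z) hn (by linarith) fun k => (hk k).2

end Closed

end TauMethod

theorem theorem3p7 {X : Type*} [NormedAddCommGroup X] [NormedSpace ℂ X] [CompleteSpace X]
    (A : TauMethod.E X →L[ℂ] TauMethod.E X) (hA : TauMethod.IsTridiagonal A)
    (n : ℕ) (hn : 1 ≤ n) :
    -- `θ_n(φ)` is the unique solution of its equation in the stated interval
    (∀ φ ∈ Set.Ioo (0 : ℝ) 1, TauMethod.thetaSolutions n φ = {TauMethod.theta n φ}) ∧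
    -- the inclusion for open pseudospectra
    (∀ ε : ℝ, 0 < ε →
      TauMethod.openPseudospectrum ε A ⊆
        TauMethod.openTauSet n (ε + TauMethod.penalty n A) A) ∧
    -- the inclusion for closed pseudospectra and, for `ε = 0`, for the spectrum
    (TauMethod.GlobevnikProperty X → ∀ ε : ℝ, 0 ≤ ε →
      (0 < ε ∨ TauMethod.subdiag A ≠ 0 ∨ TauMethod.superdiag A ≠ 0 ∨
        FiniteDimensional ℂ X) →
      TauMethod.closedPseudospectrum ε A ⊆
        TauMethod.closedTauSet n (ε + TauMethod.penalty n A) A) ∧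
    -- the penalty in the bidiagonal case
    (TauMethod.subdiag A = 0 ∨ TauMethod.superdiag A = 0 →
      TauMethod.penalty n A =
        2 * (TauMethod.supNorm (TauMethod.subdiag A) +
          TauMethod.supNorm (TauMethod.superdiag A)) * Real.sin (Real.pi / (4 * n + 2))) ∧
    -- sharpness: for the shift, both inclusions fail with any smaller penalty
    (∃ V : TauMethod.E ℂ →L[ℂ] TauMethod.E ℂ,
      (∀ (x : TauMethod.E ℂ) (j : ℤ), V x (j + 1) = x j) ∧
      TauMethod.IsTridiagonal V ∧ TauMethod.superdiag V = 0 ∧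
      TauMethod.penalty n V = 2 * Real.sin (Real.pi / (4 * n + 2)) ∧
      ∀ δ : ℝ, 0 ≤ δ → δ < TauMethod.penalty n V →
        (¬ ∀ ε : ℝ, 0 < ε →
          TauMethod.openPseudospectrum ε V ⊆ TauMethod.openTauSet n (ε + δ) V) ∧
        (¬ ∀ ε : ℝ, 0 ≤ ε →
          TauMethod.closedPseudospectrum ε V ⊆ TauMethod.closedTauSet n (ε + δ) V)) := by
  refine ⟨fun φ hφ => TauMethod.thetaSolutions_eq_singleton hn hφ,
    fun ε hε => TauMethod.openPseudospectrum_subset hA hn hε,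
    fun hX ε hε h => TauMethod.closedPseudospectrum_subset hX hA hn hε h,
    TauMethod.penalty_of_bidiagonal hn, TauMethod.shift, fun x j => ?_,
    TauMethod.isTridiagonal_shift, TauMethod.superdiag_shift, TauMethod.penalty_shift hn,
    fun δ hδ hlt => TauMethod.shift_sharp hn hδ hlt⟩
  rw [TauMethod.shift_apply, add_sub_cancel_right]
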